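/- **Setting.** All logarithms are to base $2$. Let $\tilde{\mathcal X}$ be a metric space with distance $d$ (all channel inputs, available to a dishonest Alice), $\mathcal X\subset\tilde{\mathcal X}$ a finite subset (the inputs used by an honest Alice), $(\mathcal Y,\mu)$ a $\sigma$-finite measure space, and $\{W_x\}_{x\in\tilde{\mathcal X}}$ probability distributions on $\mathcal Y$ that are absolutely continuous with respect to $\mu$, with densities $w_x$. For $x^n\in\tilde{\mathcal X}^n$ put $W_{x^n}=W_{x_1}\times\cdots\times W_{x_n}$. $\mathcal P(\mathcal X)$ is the set of probability distributions on $\mathcal X$, and $\mathcal P(\mathcal Y)$, $\mathcal P(\mathcal Y^n)$ are the sets of probability distributions that are absolutely continuous with respect to $\mu$, $\mu^n$. $\mathbb E_x$, $\mathbb V_x$ are expectation and variance for $Y\sim W_x$. $D(P\|Q)$ is the Kullback–Leibler divergence and $D_\alpha(P\|Q)=\frac1{\alpha-1}\log\mathbb E_P[(p(Y)/q(Y))^{\alpha-1}]$. For $P\in\mathcal P(\mathcal X)$ let $W_P=\sum_xP(x)W_x$, $H(X)_P=-\sum_xP(x)\log P(x)$, $I(X;Y)_P=\sum_xP(x)D(W_x\|W_P)$,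 and for $\alpha>1$ let $$I_\alpha(X;Y)_P=\min_{Q\in\mathcal P(\mathcal Y)}\frac1{\alpha-1}\log\sum_xP(x)\,2^{(\alpha-1)D_\alpha(W_x\|Q)}.$$ **Codes.** A deterministic code $(\phi,D)$ of block length $n$ consists of integers $0<\mathsf L<\mathsf M$, an encoder $\phi:\{1,\dots,\mathsf M\}\to\mathcal X^n$ and a measurable decoder that maps each $y\in\mathcal Y^n$ to a list $\Psi(y)\subset\{1,\dots,\mathsf M\}$ of at most $\mathsf L$ messages. Put $|(\phi,D)|_1=\mathsf M$, $|(\phi,D)|_2=\mathsf L$, $\epsilon_A(\phi,D)=\max_mW_{\phi(m)}(\{y: m\notin\Psi(y)\})$, and $$\delta_{D'}(D)=\sup_{x\in\tilde{\mathcal X}^n}\bigl(\text{second largest value, with multiplicity, among } W_x(\{y: m\in\Psi(y)\}),\ m=1,\dots,\mathsf M\bigr),$$ $$E(\phi)=\log\mathsf M-\min_{Q\in\mathcal P(\mathcal Y^n)}\sum_m\tfrac1{\mathsf M}D(W_{\phi(m)}\|Q),$$ $$E_\alpha(\phi)=\log\mathsf M-\min_{Q\in\mathcal P(\mathcal Y^n)}\tfrac1{\alpha-1}\log\sum_m\tfrac1{\mathsf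 M}2^{(\alpha-1)D_\alpha(W_{\phi(m)}\|Q)}.$$ A triple $(R_1,R_2,R_3)$ of reals is *ultimately deterministically achievable* if there are deterministic codes $(\phi_n,D_n)$ of block length $n$ with $\epsilon_A(\phi_n,D_n)\to0$, $\delta_{D'}(D_n)\to0$, $\frac1n\log|(\phi_n,D_n)|_i\to R_i$ for $i=1,2$, and $\liminf_n\frac1nE(\phi_n)\ge R_3$. It is *$\alpha$-ultimately deterministically achievable* if the same holds with $E_\alpha$ in place of $E$. **Conditions.** (W2) $\displaystyle\min_{x\in\mathcal X}\ \min_{P\in\mathcal P(\mathcal X\setminus\{x\})}D\Bigl(\sum_{x'\ne x}P(x')W_{x'}\Big\|W_x\Bigr)>0.$ (W3) There are measurable functions $\xi_x:\mathcal Y\to\mathbb R$ $(x\in\tilde{\mathcal X})$, each $W_x$-integrable, with $\mathbb E_x[\xi_x(Y)]=0$ for all $x\in\tilde{\mathcal X}$, with $$\frac{-1}{t}\log\sup_{x\in\mathcal X,\ x'\in\tilde{\mathcal X}:\ d(x,x')\ge r}\mathbb E_{x'}\bigl[2^{t(\xi_x(Y)-\xi_{x'}(Y))}\bigr]>0\quad\text{for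 all } r>0,\ t\in(0,1/2),$$ and with $\sup_{x\in\tilde{\mathcal X}}\mathbb V_x[\xi_x(Y)]<\infty$. (The supremum over an empty set is $0$, and $\frac{-1}{t}\log 0=+\infty$.) **Theorem.** Assume (W2) and (W3), and let $R_1,R_2,R_3\in\mathbb R$. (i) If there is $P\in\mathcal P(\mathcal X)$ with $$0<R_1-R_2<I(X;Y)_P\le R_1-R_3\le R_1<H(X)_P,$$ then $(R_1,R_2,R_3)$ is ultimately deterministically achievable. (ii) Let $\alpha>1$. If there is $P\in\mathcal P(\mathcal X)$ with $$0<R_1-R_2<I(X;Y)_P\le I_\alpha(X;Y)_P\le R_1-R_3\le R_1<H(X)_P,$$ then $(R_1,R_2,R_3)$ is $\alpha$-ultimately deterministically achievable. -/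

import Mathlib

open MeasureTheory ProbabilityTheory InformationTheory Filter Topology
open scoped ENNReal

noncomputable section

namespace SecureList

/-! ### Logarithms, exponentials and divergences to base two -/

/-- Base-two logarithm `[0, ∞] → [-∞, ∞]`. -/
def log2 (x : ℝ≥0∞) : EReal := ENNReal.log x / ((Real.log 2 : ℝ) : EReal)

/-- Base-two exponential `[-∞, ∞] → [0, ∞]`. -/
def exp2 (x : EReal) : ℝ≥0∞ := EReal.exp (x * ((Real.log 2 : ℝ) : EReal))

/-- Kullback-Leibler divergence in bits. -/
def klBits {Y : Type*} [MeasurableSpace Y] (P Q : Measure Y) : ℝ≥0∞ :=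
  klDiv P Q / ENNReal.ofReal (Real.log 2)

/-- Rényi divergence of order `α` in bits, `(α - 1)⁻¹ log₂ E_P[(p(Y) / q(Y)) ^ (α - 1)]`, where
`p` and `q` are the densities with respect to the reference measure `ref`. -/
def renyiDiv {Y : Type*} [MeasurableSpace Y] (ref : Measure Y) (α : ℝ) (P Q : Measure Y) : EReal :=
  log2 (∫⁻ y, (P.rnDeriv ref y / Q.rnDeriv ref y) ^ (α - 1) ∂P) / ((α - 1 : ℝ) : EReal)

/-- The probability distributions that are absolutely continuous with respect to `ref`. -/
def probAC {Y : Type*} [MeasurableSpace Y] (ref : Measure Y) : Set (Measure Y) :=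
  {Q | IsProbabilityMeasure Q ∧ Q ≪ ref}

/-! ### The channel

`A` is the space of all channel inputs (those available to a dishonest sender), `X` the finite
set of inputs used by the honest sender, `W a` the output distribution for the input `a`. A
distribution on `X` is an element of `stdSimplex ℝ X`. -/

section Channel

variable {A Y : Type*} [MeasurableSpace Y]

/-- The output distribution `W_P = ∑ x, P x • W x`. -/
def outDist (W : A → Measure Y) {X : Finset A} (P : X → ℝ) : Measure Y :=
  ∑ x : X, ENNReal.ofReal (P x) • W x

/-- The output distribution of `n` memoryless uses of the channel with input word `x`. -/
def wordDist (W : A → Measure Y) {n : ℕ} (x : Fin n → A) : Measure (Fin n → Y) :=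
  Measure.pi fun i => W (x i)

/-- Shannon entropy `H(X)_P` in bits. -/
def entropy {X : Finset A} (P : X → ℝ) : ℝ := -∑ x : X, P x * Real.logb 2 (P x)

/-- Mutual information `I(X;Y)_P = ∑ x, P x * D(W x ‖ W_P)`. -/
def mutualInfo (W : A → Measure Y) {X : Finset A} (P : X → ℝ) : ℝ≥0∞ :=
  ∑ x : X, ENNReal.ofReal (P x) * klBits (W x) (outDist W P)

/-- Rényi mutual information `I_α(X;Y)_P = min_Q D_α(W × P ‖ Q × P)`. On the support of `P` the
density of `W × P` with respect to `Q × P` is `w_x(y) / q(y)`, so that the divergence is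
`(α - 1)⁻¹ log₂ ∑ x, P x * E_x[(w_x(Y) / q(Y)) ^ (α - 1)]`, and the expectation in the sum is
`2 ^ ((α - 1) * D_α(W x ‖ Q))`. -/
def renyiMutualInfo (μ : Measure Y) (α : ℝ) (W : A → Measure Y) {X : Finset A} (P : X → ℝ) :
    EReal :=
  ⨅ Q ∈ probAC μ,
    log2 (∑ x : X, ENNReal.ofReal (P x) *
      exp2 (((α - 1 : ℝ) : EReal) * renyiDiv μ α (W x) Q)) / ((α - 1 : ℝ) : EReal)

/-- Non-redundancy: the smallest divergence from a mixture of the other honest outputs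
to an honest output `W x` is positive. -/
def CondW2 (W : A → Measure Y) (X : Finset A) : Prop :=
  0 < ⨅ x : X, ⨅ P ∈ {P : X → ℝ | P ∈ stdSimplex ℝ X ∧ P x = 0},
    klBits (outDist W P) (W x)

/-- `(-1 / t) log₂ sup E_{x'}[2 ^ (t (ξ_x(Y) - ξ_{x'}(Y)))]`, the supremum being over all
`x ∈ X` and `x' ∈ A` at distance at least `r`. -/
def zetaBar [MetricSpace A] (W : A → Measure Y) (X : Finset A) (ξ : A → Y → ℝ) (t r : ℝ) : EReal :=
  ((-1 / t : ℝ) : EReal) *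
    log2 (⨆ x ∈ X, ⨆ x' : A, ⨆ _ : r ≤ dist x x',
      ∫⁻ y, ENNReal.ofReal ((2 : ℝ) ^ (t * (ξ x y - ξ x' y))) ∂(W x'))

/-- Distinguishability of each honest input from all other inputs. -/
def CondW3 [MetricSpace A] (W : A → Measure Y) (X : Finset A) : Prop :=
  ∃ ξ : A → Y → ℝ,
    (∀ a, Measurable (ξ a)) ∧
    (∀ a, Integrable (ξ a) (W a) ∧ ∫ y, ξ a y ∂(W a) = 0) ∧
    (∀ r : ℝ, 0 < r → ∀ t ∈ Set.Ioo (0 : ℝ) (1 / 2), 0 < zetaBar W X ξ t r) ∧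
    (⨆ a, evariance (ξ a) (W a)) < ⊤

end Channel

/-! ### Codes -/

/-- A deterministic code of block length `n` with `M` messages and lists of at most `L` messages:
the encoder uses honest inputs only, and the decoder maps an output word to a list. -/
structure Code {A : Type*} (X : Finset A) (Y : Type*) [MeasurableSpace Y] (n : ℕ) where
  M : ℕ
  L : ℕ
  L_pos : 0 < L
  L_lt_M : L < M
  enc : Fin M → Fin n → X
  dec : (Fin n → Y) → Finset (Fin M)
  card_dec_le : ∀ y, (dec y).card ≤ L
  measurableSet_dec : ∀ S, MeasurableSet (dec ⁻¹' {S})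

namespace Code

variable {A Y : Type*} [MeasurableSpace Y] {X : Finset A} {n : ℕ}

/-- The word of channel inputs that encodes the message `m`. -/
def word (C : Code X Y n) (m : Fin C.M) : Fin n → A := fun i => (C.enc m i : A)

/-- `ε_{A,m}(x, D)`: the probability that `m` is not in the list when the word `x` is sent. -/
def missProb (W : A → Measure Y) (C : Code X Y n) (x : Fin n → A) (m : Fin C.M) : ℝ≥0∞ :=
  1 - wordDist W x {y | m ∈ C.dec y}

/-- `ε_A(φ, D) = max_m ε_{A,m}(φ(m), D)`. -/
def epsA (W : A → Measure Y) (C : Code X Y n) : ℝ≥0∞ :=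
  ⨆ m : Fin C.M, C.missProb W (C.word m) m

/-- The second largest value, counted with multiplicity, of a finite family. -/
def secondLargest {ι : Type*} (f : ι → ℝ≥0∞) : ℝ≥0∞ :=
  ⨆ (i : ι) (j : ι) (_ : i ≠ j), min (f i) (f j)

/-- `δ_{D'}(D)`: the largest, over all words of inputs in `A`, second largest
probability that a message is in the list. -/
def deltaD' (W : A → Measure Y) (C : Code X Y n) : ℝ≥0∞ :=
  ⨆ x : Fin n → A, secondLargest fun m => 1 - C.missProb W x m

/-- The equivocation `E(φ) = log₂ M - min_Q ∑ m, M⁻¹ D(W_{φ(m)} ‖ Q)`. -/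
def equivocation (μ : Measure Y) (W : A → Measure Y) (C : Code X Y n) : EReal :=
  ((Real.logb 2 C.M : ℝ) : EReal) -
    ((⨅ Q ∈ probAC (Measure.pi fun _ : Fin n => μ),
      ∑ m : Fin C.M, (C.M : ℝ≥0∞)⁻¹ * klBits (wordDist W (C.word m)) Q : ℝ≥0∞) : EReal)

/-- The Rényi equivocation
`E_α(φ) = log₂ M - min_Q (α - 1)⁻¹ log₂ ∑ m, M⁻¹ 2 ^ ((α - 1) D_α(W_{φ(m)} ‖ Q))`. -/
def renyiEquivocation (μ : Measure Y) (α : ℝ) (W : A → Measure Y) (C : Code X Y n) : EReal :=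
  ((Real.logb 2 C.M : ℝ) : EReal) -
    ⨅ Q ∈ probAC (Measure.pi fun _ : Fin n => μ),
      log2 (∑ m : Fin C.M, (C.M : ℝ≥0∞)⁻¹ *
        exp2 (((α - 1 : ℝ) : EReal) *
          renyiDiv (Measure.pi fun _ : Fin n => μ) α (wordDist W (C.word m)) Q)) /
        ((α - 1 : ℝ) : EReal)

end Code

/-! ### Achievability -/

section Achievability

variable {A Y : Type*} [MeasurableSpace Y]

/-- A sequence of codes is ultimately secure when `ε_A` and `δ_{D'}` tend to zero. -/
def UltimatelySecure (W : A → Measure Y) {X : Finset A} (C : ∀ n, Code X Y n) : Prop :=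
  Tendsto (fun n => (C n).epsA W) atTop (𝓝 0) ∧
  Tendsto (fun n => (C n).deltaD' W) atTop (𝓝 0)

/-- The message size and the list size grow with the rates `R₁` and `R₂`. -/
def HasRates {X : Finset A} (C : ∀ n, Code X Y n) (R₁ R₂ : ℝ) : Prop :=
  Tendsto (fun n : ℕ => 1 / (n : ℝ) * Real.logb 2 ((C n).M : ℝ)) atTop (𝓝 R₁) ∧
  Tendsto (fun n : ℕ => 1 / (n : ℝ) * Real.logb 2 ((C n).L : ℝ)) atTop (𝓝 R₂)

/-- Ultimate deterministic achievability of a rate triple. -/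
def UltimatelyAchievable (μ : Measure Y) (W : A → Measure Y) (X : Finset A) (R₁ R₂ R₃ : ℝ) :
    Prop :=
  ∃ C : ∀ n, Code X Y n, UltimatelySecure W C ∧ HasRates C R₁ R₂ ∧
    (R₃ : EReal) ≤
      liminf (fun n : ℕ => ((1 / n : ℝ) : EReal) * (C n).equivocation μ W) atTop

/-- `α`-ultimate deterministic achievability of a rate triple. -/
def RenyiUltimatelyAchievable (μ : Measure Y) (α : ℝ) (W : A → Measure Y) (X : Finset A)
    (R₁ R₂ R₃ : ℝ) : Prop :=
  ∃ C : ∀ n, Code X Y n, UltimatelySecure W C ∧ HasRates C R₁ R₂ ∧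
    (R₃ : EReal) ≤
      liminf (fun n : ℕ => ((1 / n : ℝ) : EReal) * (C n).renyiEquivocation μ α W) atTop

end Achievability

end SecureList

end

open MeasureTheory ProbabilityTheory InformationTheory Filter Topology
open scoped ENNReal

noncomputable section

namespace SecureList

/-! ### Finite product measures -/

section Products

/-! The codewords are random words with independent letters of law `P`, and each requirement on the
code rests on a different property of them.

Reliability: a message is a candidate if the density of its codeword relative to the `n`-fold power
of `W_P` reaches a threshold `θ` slightly above `2^(n(R₁-R₂))`. As `R₁ - R₂ < I(X;Y)_P`, Chebyshev's
inequality shows that a typical sent codeword passes. An independent random codeword has expected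
density one, so by Markov's inequality about `M/θ` false candidates remain on average, exponentially
fewer than `L` (`pi_compl_listRegion_le`).

Security: as `R₁ < H(X)_P`, and small Hamming balls contain few typical words, the codewords can be
kept at pairwise Hamming distance at least `ηn` (`pi_mix_dirac_hammingBall_le`). Distinct honest
letters are at distance at least `2r`, so any word of a dishonest sender is `r`-far, in at least
`ηn/2` positions, from one of any two codewords. The test built from (W3) then rejects that codeword
(`CondW3.exists_verification`). A message is listed only if it is a candidate and passes its test,
hence no two messages are both listed with high probability.

Equivocation: the minimum over output distributions is at most the value at a power of a
single-letter `Q`. There the divergence of a codeword is a sum of a letter function `u`, which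
typicality keeps below `n(∑ P u + δ)` for every codeword. For `E` one takes `Q = W_P` and gets
`I(X;Y)_P`; for `E_α` one takes a nearly optimal `Q`, and Jensen's inequality bounds `∑ P u`.

Selection with expurgation (`exists_codewords`) gives all the properties of the codewords at once in
`exists_listCode`. A diagonal choice over the tolerances produces the sequence of codes. -/

theorem lintegral_pi_prod {E : Type*} [MeasurableSpace E] {n : ℕ} (ρ : Fin n → Measure E)
    [∀ i, SigmaFinite (ρ i)] (f : Fin n → E → ℝ≥0∞) (hf : ∀ i, Measurable (f i)) :
    ∫⁻ y, ∏ i, f i (y i) ∂(Measure.pi ρ) = ∏ i, ∫⁻ y, f i y ∂(ρ i) := by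
  induction n with
  | zero => simp
  | succ n ih =>
    have h := (measurePreserving_piFinSuccAbove ρ 0).symm
    rw [← h.lintegral_comp_emb (MeasurableEquiv.measurableEmbedding _)]
    simp_rw [MeasurableEquiv.piFinSuccAbove_symm_apply, Fin.insertNthEquiv,
      Fin.prod_univ_succ, Fin.insertNth_zero]
    simp only [Fin.zero_succAbove, Equiv.coe_fn_mk, cast_eq]
    have hm : Measurable fun y : Fin n → E => ∏ i, f (Fin.succ i) (y i) :=
      Finset.measurable_fun_prod _ fun i _ => (hf _).comp (measurable_pi_apply i)
    refine (lintegral_prod_mul (hf 0).aemeasurable hm.aemeasurable).trans ?_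
    rw [ih (fun i => ρ i.succ) (fun i => f i.succ) fun i => hf _]

/-- It suffices to compare boxes, on which the indicator times the density is again a product over
the coordinates. -/
theorem pi_withDensity {E : Type*} [MeasurableSpace E] {n : ℕ} (ρ σ : Fin n → Measure E)
    [∀ i, SigmaFinite (ρ i)] [∀ i, SigmaFinite (σ i)] (f : Fin n → E → ℝ≥0∞)
    (hf : ∀ i, Measurable (f i)) (hσ : ∀ i, (ρ i).withDensity (f i) = σ i) :
    (Measure.pi ρ).withDensity (fun y => ∏ i, f i (y i)) = Measure.pi σ := by
  symm
  apply Measure.pi_eq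
  intro s hs
  rw [withDensity_apply _ (MeasurableSet.univ_pi hs),
    ← lintegral_indicator (MeasurableSet.univ_pi hs)]
  have : (Set.univ.pi s).indicator (fun y => ∏ i, f i (y i)) =
      fun y => ∏ i, (s i).indicator (f i) (y i) := by
    ext y
    by_cases hy : y ∈ Set.univ.pi s
    · rw [Set.indicator_of_mem hy]
      refine Finset.prod_congr rfl fun i _ => ?_
      rw [Set.indicator_of_mem (hy i (Set.mem_univ i))]
    · rw [Set.indicator_of_notMem hy]
      simp only [Set.mem_pi, Set.mem_univ, true_imp_iff, not_forall] at hy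
      obtain ⟨i, hi⟩ := hy
      exact (Finset.prod_eq_zero (Finset.mem_univ i) (Set.indicator_of_notMem hi _)).symm
  rw [this, lintegral_pi_prod ρ _ fun i => (hf i).indicator (hs i)]
  refine Finset.prod_congr rfl fun i _ => ?_
  rw [lintegral_indicator (hs i), ← withDensity_apply _ (hs i), hσ]

theorem pi_withDensity_rnDeriv {E : Type*} [MeasurableSpace E] {n : ℕ} (ρ σ : Fin n → Measure E)
    [∀ i, SigmaFinite (ρ i)] [∀ i, SigmaFinite (σ i)] (h : ∀ i, σ i ≪ ρ i) :
    (Measure.pi ρ).withDensity (fun y => ∏ i, (σ i).rnDeriv (ρ i) (y i)) = Measure.pi σ :=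
  pi_withDensity ρ σ _ (fun _ => Measure.measurable_rnDeriv _ _)
    fun i => Measure.withDensity_rnDeriv_eq _ _ (h i)

theorem pi_absolutelyContinuous {E : Type*} [MeasurableSpace E] {n : ℕ} (ρ σ : Fin n → Measure E)
    [∀ i, SigmaFinite (ρ i)] [∀ i, SigmaFinite (σ i)] (h : ∀ i, σ i ≪ ρ i) :
    Measure.pi σ ≪ Measure.pi ρ := by
  rw [← pi_withDensity_rnDeriv ρ σ h]
  exact withDensity_absolutelyContinuous _ _

theorem rnDeriv_pi {E : Type*} [MeasurableSpace E] {n : ℕ} (ρ σ : Fin n → Measure E)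
    [∀ i, SigmaFinite (ρ i)] [∀ i, SigmaFinite (σ i)] (h : ∀ i, σ i ≪ ρ i) :
    (Measure.pi σ).rnDeriv (Measure.pi ρ) =ᵐ[Measure.pi ρ]
      fun y => ∏ i, (σ i).rnDeriv (ρ i) (y i) := by
  rw [← pi_withDensity_rnDeriv ρ σ h]
  exact Measure.rnDeriv_withDensity _ (Finset.measurable_fun_prod _ fun i _ =>
    (Measure.measurable_rnDeriv _ _).comp (measurable_pi_apply i))

theorem ae_pi_of_ae {E : Type*} [MeasurableSpace E] {n : ℕ} (ρ : Fin n → Measure E)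
    [∀ i, IsProbabilityMeasure (ρ i)] {q : Fin n → E → Prop} (h : ∀ i, ∀ᵐ y ∂(ρ i), q i y) :
    ∀ᵐ y ∂(Measure.pi ρ), ∀ i, q i (y i) :=
  ae_all_iff.2 fun i => (measurePreserving_eval ρ i).quasiMeasurePreserving.ae (h i)

/-- Chebyshev's inequality for a sum of independent variables. -/
theorem measure_pi_sum_sub_integral_ge_le {E : Type*} [MeasurableSpace E] {n : ℕ} (hn : 0 < n)
    (ρ : Fin n → Measure E) [∀ i, IsProbabilityMeasure (ρ i)] (f : Fin n → E → ℝ)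
    (hf : ∀ i, MemLp (f i) 2 (ρ i)) {v : ℝ} (hv : ∀ i, Var[f i; ρ i] ≤ v) {c : ℝ} (hc : 0 < c) :
    Measure.pi ρ {y | c * n ≤ |∑ i, f i (y i) - ∑ i, ∫ y, f i y ∂(ρ i)|} ≤
      ENNReal.ofReal (v / (c ^ 2 * n)) := by
  have hn' : (0 : ℝ) < n := Nat.cast_pos.2 hn
  have hL : ∀ i, MemLp (fun y : Fin n → E => f i (y i)) 2 (Measure.pi ρ) := fun i =>
    (hf i).comp_measurePreserving (measurePreserving_eval ρ i)
  have hsum : MemLp (fun y : Fin n → E => ∑ i, f i (y i)) 2 (Measure.pi ρ) :=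
    memLp_finsetSum _ fun i _ => hL i
  have hmean : ∫ y, ∑ i, f i (y i) ∂(Measure.pi ρ) = ∑ i, ∫ y, f i y ∂(ρ i) := by
    rw [integral_finsetSum _ fun i _ => (hL i).integrable one_le_two]
    exact Finset.sum_congr rfl fun i _ => integral_comp_eval (hf i).1
  have hvar : Var[fun y : Fin n → E => ∑ i, f i (y i); Measure.pi ρ] ≤ n * v := by
    have := variance_sum_pi (μ := ρ) (X := f) hf
    have e : (∑ i, fun ω : Fin n → E => f i (ω i)) = fun y => ∑ i, f i (y i) := by
      ext y; simp
    rw [e] at this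
    rw [this]
    calc ∑ i, Var[f i; ρ i] ≤ ∑ _i : Fin n, v := Finset.sum_le_sum fun i _ => hv i
      _ = n * v := by simp
  have h := meas_ge_le_variance_div_sq hsum (mul_pos hc hn')
  rw [hmean] at h
  refine h.trans (ENNReal.ofReal_le_ofReal ?_)
  rw [div_le_div_iff₀ (by positivity) (by positivity)]
  calc _ ≤ (n * v) * (c ^ 2 * n) := by gcongr
    _ = _ := by ring

end Products

/-! ### Densities with respect to the output distribution of a finite channel -/

section Mixture

variable {S Y : Type*} [Fintype S] [MeasurableSpace Y]

/-- The mixture `∑ s, p s • V s`. -/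
def mix (V : S → Measure Y) (p : S → ℝ) : Measure Y := ∑ s, ENNReal.ofReal (p s) • V s

variable (V : S → Measure Y) (p : S → ℝ)

/-- The density of `V s` with respect to the mixture. -/
def dens (s : S) : Y → ℝ≥0∞ := (V s).rnDeriv (mix V p)

theorem measurable_dens (s : S) : Measurable (dens V p s) := Measure.measurable_rnDeriv _ _

theorem sum_ofReal_eq_one {p : S → ℝ} (hp : ∀ s, 0 ≤ p s) (hp1 : ∑ s, p s = 1) :
    ∑ s, ENNReal.ofReal (p s) = 1 := by
  rw [← ENNReal.ofReal_sum_of_nonneg fun s _ => hp s, hp1, ENNReal.ofReal_one]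

theorem isProbabilityMeasure_mix [∀ s, IsProbabilityMeasure (V s)] {p : S → ℝ}
    (hp : ∀ s, 0 ≤ p s) (hp1 : ∑ s, p s = 1) : IsProbabilityMeasure (mix V p) := by
  constructor
  simp [mix, Measure.finsetSum_apply, sum_ofReal_eq_one hp hp1]

instance [∀ s, IsProbabilityMeasure (V s)] : IsFiniteMeasure (mix V p) := by
  constructor
  simp [mix, Measure.finsetSum_apply, ENNReal.sum_lt_top]

theorem absolutelyContinuous_mix {p : S → ℝ} (hp : ∀ s, 0 < p s) (s : S) : V s ≪ mix V p := by
  intro A hA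
  simp only [mix, Measure.finsetSum_apply, Measure.smul_apply, smul_eq_mul,
    Finset.sum_eq_zero_iff, Finset.mem_univ, true_imp_iff, mul_eq_zero] at hA
  exact (hA s).resolve_left (by simpa using hp s)

variable [∀ s, IsProbabilityMeasure (V s)] {p} (hp : ∀ s, 0 < p s)

include hp in
theorem withDensity_dens (s : S) : (mix V p).withDensity (dens V p s) = V s :=
  Measure.withDensity_rnDeriv_eq _ _ (absolutelyContinuous_mix V hp s)

include hp in
theorem sum_dens : ∀ᵐ y ∂(mix V p), ∑ s, ENNReal.ofReal (p s) * dens V p s y = 1 := by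
  have hm : Measurable fun y => ∑ s, ENNReal.ofReal (p s) * dens V p s y :=
    Finset.measurable_fun_sum _ fun s _ => (measurable_dens V p s).const_mul _
  have h1 : (mix V p).withDensity (fun y => ∑ s, ENNReal.ofReal (p s) * dens V p s y) =
      (mix V p).withDensity fun _ => 1 := by
    ext A hA
    rw [withDensity_apply _ hA, withDensity_apply _ hA,
      lintegral_finsetSum _ fun s _ => (measurable_dens V p s).const_mul _]
    simp_rw [lintegral_const_mul _ (measurable_dens V p _), ← withDensity_apply _ hA,
      withDensity_dens V hp]
    simp [mix, Measure.finsetSum_apply]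
  exact (withDensity_eq_iff_of_sigmaFinite hm.aemeasurable aemeasurable_const).1 h1

include hp in
-- `p s * dens V p s` is one nonnegative summand of a sum equal to one. This boundedness gives the
-- log-likelihood ratios finite variance without any assumption on the channel.
theorem dens_le (s : S) : ∀ᵐ y ∂(mix V p), dens V p s y ≤ ENNReal.ofReal (1 / p s) := by
  filter_upwards [sum_dens V hp] with y hy
  have h1 : ENNReal.ofReal (p s) * dens V p s y ≤ 1 :=
    hy ▸ Finset.single_le_sum (f := fun s => ENNReal.ofReal (p s) * dens V p s y)
      (fun _ _ => zero_le) (Finset.mem_univ s)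
  have h2 : ENNReal.ofReal (p s) ≠ 0 := by simpa using hp s
  rw [one_div, ENNReal.ofReal_inv_of_pos (hp s)]
  rwa [ENNReal.le_inv_iff_mul_le, mul_comm]

/-- Below one, `z log² z = 4 (√z log √z)²` and `|t log t| < 1` for `0 < t ≤ 1`; above one, `log z ≤
z ≤ C`. -/
theorem mul_log_sq_le {z C : ℝ} (hz : 0 ≤ z) (hC : z ≤ C) : z * Real.log z ^ 2 ≤ 4 + C ^ 3 := by
  have hC0 : 0 ≤ C := hz.trans hC
  rcases hz.eq_or_lt with rfl | hz0
  · simp; positivity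
  rcases le_total z 1 with h1 | h1
  · have hs : 0 < √z := Real.sqrt_pos.2 hz0
    have h := Real.abs_log_mul_self_lt (√z) hs (by simpa using h1)
    have e : z * Real.log z ^ 2 = 4 * (Real.log √z * √z) ^ 2 := by
      rw [Real.log_sqrt hz, mul_pow, div_pow, Real.sq_sqrt hz]; ring
    have : (Real.log √z * √z) ^ 2 ≤ 1 := (sq_le_one_iff_abs_le_one _).2 h.le
    have : 0 ≤ C ^ 3 := by positivity
    rw [e]; linarith
  · have hl : Real.log z ≤ z := (Real.log_le_sub_one_of_pos hz0).trans (by linarith)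
    have hl0 := Real.log_nonneg h1
    calc z * Real.log z ^ 2 ≤ C * C ^ 2 := by gcongr; exact hl.trans hC
      _ ≤ 4 + C ^ 3 := by nlinarith

include hp in
-- Written against the mixture, the second moment is the integral of `z log² z` for the bounded
-- density `z`.
theorem memLp_llr_mix (s : S) : MemLp (llr (V s) (mix V p)) 2 (V s) := by
  have hm : Measurable (llr (V s) (mix V p)) := measurable_llr _ _
  rw [memLp_two_iff_integrable_sq hm.aestronglyMeasurable,
    ← integrable_rnDeriv_smul_iff (absolutelyContinuous_mix V hp s)]
  refine Integrable.of_bound (C := 4 + (1 / p s) ^ 3)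
    (by fun_prop) ?_
  filter_upwards [dens_le V hp s] with y hy
  have h0 : 0 ≤ ((V s).rnDeriv (mix V p) y).toReal := ENNReal.toReal_nonneg
  rw [Real.norm_of_nonneg (by rw [smul_eq_mul]; positivity), smul_eq_mul, llr]
  exact mul_log_sq_le h0 (ENNReal.toReal_le_of_le_ofReal (by have := hp s; positivity) hy)

include hp in
theorem integrable_llr_mix (s : S) : Integrable (llr (V s) (mix V p)) (V s) :=
  (memLp_llr_mix V hp s).integrable one_le_two

include hp in
theorem klDiv_mix_ne_top (s : S) : klDiv (V s) (mix V p) ≠ ⊤ :=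
  klDiv_ne_top (absolutelyContinuous_mix V hp s) (integrable_llr_mix V hp s)

include hp in
theorem integral_llr_mix (hp1 : ∑ s, p s = 1) (s : S) :
    ∫ y, llr (V s) (mix V p) y ∂(V s) = (klDiv (V s) (mix V p)).toReal := by
  have := isProbabilityMeasure_mix V (fun s => (hp s).le) hp1
  rw [toReal_klDiv_of_measure_eq (absolutelyContinuous_mix V hp s) (by simp)]

include hp in
theorem dens_pos_lt_top (s : S) : ∀ᵐ y ∂(V s), 0 < dens V p s y ∧ dens V p s y < ⊤ :=
  (Measure.rnDeriv_pos (absolutelyContinuous_mix V hp s)).and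
    ((absolutelyContinuous_mix V hp s).ae_le (Measure.rnDeriv_lt_top _ _))

/-- The expected density of `V b` under `V a`. -/
def crossDens (p : S → ℝ) (a b : S) : ℝ≥0∞ := ∫⁻ y, dens V p b y ∂(V a)

include hp in
-- Both sides integrate the product of the two densities against the mixture. The symmetry is needed
-- for the pair penalty in the selection of codewords.
theorem crossDens_comm (a b : S) : crossDens V p a b = crossDens V p b a := by
  have h : ∀ a b, crossDens V p a b = ∫⁻ y, dens V p a y * dens V p b y ∂(mix V p) := by
    intro a b
    have := lintegral_withDensity_eq_lintegral_mul (mix V p) (measurable_dens V p a)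
      (measurable_dens V p b)
    rw [withDensity_dens V hp] at this
    exact this
  rw [h, h]
  simp_rw [mul_comm]

include hp in
-- The densities average to one almost everywhere. This is the random coding estimate: an
-- independent letter of law `p` has expected density one under any `V a`.
theorem sum_crossDens (a : S) : ∑ b, ENNReal.ofReal (p b) * crossDens V p a b = 1 := by
  simp_rw [crossDens, ← lintegral_const_mul _ (measurable_dens V p _)]
  rw [← lintegral_finsetSum _ fun s _ => (measurable_dens V p s).const_mul _,
    lintegral_congr_ae ((absolutelyContinuous_mix V hp a).ae_le (sum_dens V hp))]
  simp

/-! ### Words -/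

variable {n : ℕ}

/-- The density of the output distribution of a word. -/
def wordDens (p : S → ℝ) (x : Fin n → S) (y : Fin n → Y) : ℝ≥0∞ := ∏ i, dens V p (x i) (y i)

omit [∀ s, IsProbabilityMeasure (V s)] in
theorem measurable_wordDens (x : Fin n → S) : Measurable (wordDens V p x) :=
  Finset.measurable_fun_prod _ fun i _ =>
    (measurable_dens V p (x i)).comp (measurable_pi_apply i)

/-- The expected density of the word `x'` under the output distribution of the word `x`. -/
def wordCrossDens (p : S → ℝ) (x x' : Fin n → S) : ℝ≥0∞ := ∏ i, crossDens V p (x i) (x' i)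

include hp in
theorem wordCrossDens_comm (x x' : Fin n → S) :
    wordCrossDens V p x x' = wordCrossDens V p x' x :=
  Finset.prod_congr rfl fun _ _ => crossDens_comm V hp _ _

theorem pi_wordDens_ge_le (x x' : Fin n → S) {θ : ℝ≥0∞} (h0 : θ ≠ 0) (ht : θ ≠ ⊤) :
    Measure.pi (fun i => V (x i)) {y | θ ≤ wordDens V p x' y} ≤ wordCrossDens V p x x' / θ := by
  rw [ENNReal.le_div_iff_mul_le (Or.inl h0) (Or.inl ht), mul_comm]
  refine (mul_meas_ge_le_lintegral (measurable_wordDens V x') θ).trans_eq ?_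
  exact lintegral_pi_prod _ _ fun i => measurable_dens V p (x' i)

include hp in
theorem exists_pi_wordDens_lt_le (hp1 : ∑ s, p s = 1) : ∃ v : ℝ, ∀ (n : ℕ), 0 < n →
    ∀ (x : Fin n → S) (r c : ℝ), 0 < c →
    (r + c) * n ≤ ∑ i, (klDiv (V (x i)) (mix V p)).toReal →
    Measure.pi (fun i => V (x i)) {y | wordDens V p x y < ENNReal.ofReal (Real.exp (n * r))} ≤
      ENNReal.ofReal (v / (c ^ 2 * n)) := by
  -- The sum of all letter variances bounds each of them, so the constant depends neither on `n` nor
  -- on the word.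
  refine ⟨∑ s, Var[llr (V s) (mix V p); V s], fun n hn x r c hc hx => ?_⟩
  have h := measure_pi_sum_sub_integral_ge_le hn (fun i => V (x i))
    (fun i => llr (V (x i)) (mix V p)) (fun i => memLp_llr_mix V hp (x i))
    (v := ∑ s, Var[llr (V s) (mix V p); V s])
    (fun i => Finset.single_le_sum (f := fun s => Var[llr (V s) (mix V p); V s])
      (fun s _ => variance_nonneg _ _) (Finset.mem_univ (x i))) hc
  refine (measure_mono_ae ?_).trans h
  filter_upwards [ae_pi_of_ae (fun i => V (x i)) fun i => dens_pos_lt_top V hp (x i)] with y hy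
  intro (hlt : wordDens V p x y < _)
  change _ ≤ |_|
  simp_rw [integral_llr_mix V hp hp1]
  have e : ∑ i, llr (V (x i)) (mix V p) (y i) = Real.log (wordDens V p x y).toReal := by
    rw [wordDens, ENNReal.toReal_prod, Real.log_prod]
    · rfl
    · intro i _
      exact (ENNReal.toReal_pos (hy i).1.ne' (hy i).2.ne).ne'
  have hpos : 0 < (wordDens V p x y).toReal := by
    rw [wordDens, ENNReal.toReal_prod]
    exact Finset.prod_pos fun i _ => ENNReal.toReal_pos (hy i).1.ne' (hy i).2.ne
  have h2 : Real.log (wordDens V p x y).toReal ≤ n * r := by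
    rw [Real.log_le_iff_le_exp hpos]
    exact ENNReal.toReal_le_of_le_ofReal (Real.exp_pos _).le hlt.le
  rw [e, abs_sub_comm]
  refine le_trans ?_ (le_abs_self _)
  nlinarith

end Mixture

/-! ### Choosing codewords -/

section Selection

/-- The words are added one at a time, each no worse than the average. By symmetry a new word meets
every earlier one in two ordered pairs, whence the factor two. -/
theorem exists_codewords_sum_le {Ω : Type*} [MeasurableSpace Ω] (Q : Measure Ω)
    [IsProbabilityMeasure Q] (f : Ω → ℝ≥0∞) (g : Ω → Ω → ℝ≥0∞) (hf : Measurable f)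
    (hg : ∀ x, Measurable (g x)) (hsymm : ∀ x x', g x x' = g x' x) {a b : ℝ≥0∞}
    (ha : ∫⁻ x, f x ∂Q ≤ a) (hb : ∀ x, ∫⁻ x', g x x' ∂Q ≤ b) (N : ℕ) :
    ∃ c : Fin N → Ω, ∑ m, (f (c m) + ∑ m', if m' = m then 0 else g (c m) (c m')) ≤
      N * a + N ^ 2 * b := by
  induction N with
  | zero => exact ⟨Fin.elim0, by simp⟩
  | succ N ih =>
    obtain ⟨c, hc⟩ := ih
    have hm : Measurable fun x => f x + 2 * ∑ m, g (c m) x :=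
      hf.add ((Finset.measurable_fun_sum _ fun m _ => hg (c m)).const_mul _)
    obtain ⟨x, hx⟩ := exists_le_lintegral hm.aemeasurable (μ := Q)
    have hx' : f x + 2 * ∑ m, g (c m) x ≤ a + 2 * (N * b) := by
      refine hx.trans ?_
      rw [lintegral_add_left hf, lintegral_const_mul _ (Finset.measurable_fun_sum _
        fun m _ => hg (c m)), lintegral_finsetSum _ fun m _ => hg (c m)]
      gcongr
      exact (Finset.sum_le_sum fun m _ => hb (c m)).trans_eq (by simp)
    refine ⟨Fin.cons x c, ?_⟩
    simp only [Fin.sum_univ_succ, Fin.cons_zero, Fin.cons_succ, if_true, zero_add,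
      Fin.succ_ne_zero, if_false, (Fin.succ_ne_zero _).symm, Fin.succ_inj]
    calc _ = (∑ m, (f (c m) + ∑ m', if m' = m then 0 else g (c m) (c m'))) +
          (f x + 2 * ∑ m, g (c m) x) := by
          simp only [Finset.sum_add_distrib, hsymm x]
          ring
      _ ≤ (N * a + N ^ 2 * b) + (a + 2 * (N * b)) := add_le_add hc hx'
      -- The extra `b` completes the square `(N + 1)² = N² + 2N + 1`.
      _ ≤ (N * a + N ^ 2 * b) + (a + 2 * (N * b)) + b := le_self_add
      _ = _ := by push_cast; ring

theorem exists_embedding_le {M : ℕ} (v : Fin (2 * M) → ℝ≥0∞) {ε : ℝ≥0∞} (h0 : ε ≠ 0) (ht : ε ≠ ⊤)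
    (h : ∑ m, v m ≤ (2 * M : ℕ) * ε) : ∃ e : Fin M ↪ Fin (2 * M), ∀ m, v (e m) ≤ 2 * ε := by
  classical
  -- Markov's inequality: at most half of the `2 * M` indices exceed twice the average bound.
  set bad := Finset.univ.filter fun m => 2 * ε < v m with hbad
  have h1 : (bad.card : ℝ≥0∞) * (2 * ε) ≤ M * (2 * ε) := by
    calc (bad.card : ℝ≥0∞) * (2 * ε) = ∑ m ∈ bad, 2 * ε := by simp
      _ ≤ ∑ m ∈ bad, v m := Finset.sum_le_sum fun m hm => (Finset.mem_filter.1 hm).2.le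
      _ ≤ ∑ m, v m := Finset.sum_le_sum_of_subset (Finset.subset_univ _)
      _ ≤ _ := h
      _ = _ := by push_cast; ring
  have h2 : bad.card ≤ M := by
    rw [ENNReal.mul_le_mul_iff_left (by simp [h0]) (ENNReal.mul_ne_top (by simp) ht)] at h1
    exact_mod_cast h1
  have h3 : M ≤ badᶜ.card := by
    rw [Finset.card_compl, Fintype.card_fin]; omega
  refine ⟨(Fin.castLEEmb h3).trans (badᶜ.orderEmbOfFin rfl).toEmbedding, fun m => ?_⟩
  have hmem := (badᶜ).orderEmbOfFin_mem rfl (Fin.castLE h3 m)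
  exact not_lt.1 fun hlt =>
    Finset.mem_compl.1 hmem (Finset.mem_filter.2 ⟨Finset.mem_univ _, hlt⟩)

/-- Random choice of twice as many codewords followed by expurgation of the worse half. -/
theorem exists_codewords {Ω : Type*} [MeasurableSpace Ω] (Q : Measure Ω)
    [IsProbabilityMeasure Q] (f : Ω → ℝ≥0∞) (g : Ω → Ω → ℝ≥0∞) (hf : Measurable f)
    (hg : ∀ x, Measurable (g x)) (hsymm : ∀ x x', g x x' = g x' x) {a b ε : ℝ≥0∞}
    (ha : ∫⁻ x, f x ∂Q ≤ a) (hb : ∀ x, ∫⁻ x', g x x' ∂Q ≤ b) (M : ℕ)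
    (h0 : ε ≠ 0) (ht : ε ≠ ⊤) (hε : a + 2 * M * b ≤ ε) :
    ∃ c : Fin M → Ω, ∀ m, f (c m) + ∑ m', (if m' = m then 0 else g (c m) (c m')) ≤ 2 * ε := by
  obtain ⟨c, hc⟩ := exists_codewords_sum_le Q f g hf hg hsymm ha hb (2 * M)
  obtain ⟨e, he⟩ := exists_embedding_le
    (fun m => f (c m) + ∑ m', if m' = m then 0 else g (c m) (c m')) h0 ht (by
      refine hc.trans ?_
      calc _ = ((2 * M : ℕ) : ℝ≥0∞) * (a + 2 * M * b) := by push_cast; ring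
        _ ≤ _ := by gcongr)
  refine ⟨c ∘ e, fun m => le_trans ?_ (he m)⟩
  dsimp only [Function.comp_apply]
  gcongr
  calc _ = ∑ m' ∈ Finset.univ.map e, (if m' = e m then 0 else g (c (e m)) (c m')) := by
        simp [Finset.sum_map]
    _ ≤ _ := Finset.sum_le_sum_of_subset (Finset.subset_univ _)

/-- A Chernoff bound for counting: since `s ≤ 1`, each word of the ball satisfies `s ^ r ≤ s ^
hammingDist x x'`, and the sum of the latter over all words factors over the coordinates. -/
theorem card_hammingBall_mul_le {S : Type*} [Fintype S] [DecidableEq S] {n : ℕ} (x : Fin n → S)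
    {s r : ℝ} (hs0 : 0 < s) (hs1 : s ≤ 1) :
    ((Finset.univ.filter fun x' => (hammingDist x x' : ℝ) < r).card : ℝ) * s ^ r ≤
      (1 + Fintype.card S * s) ^ n := by
  calc _ = ∑ x' ∈ Finset.univ.filter fun x' => (hammingDist x x' : ℝ) < r, s ^ r := by simp
    _ ≤ ∑ x' ∈ Finset.univ.filter fun x' => (hammingDist x x' : ℝ) < r, s ^ hammingDist x x' := by
        refine Finset.sum_le_sum fun x' hx' => ?_
        rw [← Real.rpow_natCast]
        exact Real.rpow_le_rpow_of_exponent_ge hs0 hs1 (Finset.mem_filter.1 hx').2.le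
    _ ≤ ∑ x', s ^ hammingDist x x' :=
        Finset.sum_le_sum_of_subset_of_nonneg (Finset.subset_univ _) fun _ _ _ => by positivity
    _ = ∑ x' : Fin n → S, ∏ i, (if x i ≠ x' i then s else 1) := by
        refine Finset.sum_congr rfl fun x' _ => ?_
        rw [Finset.prod_ite]
        simp [hammingDist]
    _ = ∏ i, ∑ a, (if x i ≠ a then s else 1) := by
        rw [Finset.prod_univ_sum, Fintype.piFinset_univ]
    _ ≤ ∏ _i : Fin n, (1 + Fintype.card S * s) := by
        refine Finset.prod_le_prod
          (fun i _ => Finset.sum_nonneg fun a _ => by split_ifs <;> positivity) fun i _ => ?_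
        calc ∑ a, (if x i ≠ a then s else 1) ≤ ∑ a, ((if x i = a then 1 else 0) + s) :=
              Finset.sum_le_sum fun a _ => by by_cases h : x i = a <;> simp [h, hs0.le]
          _ = _ := by simp [Finset.sum_add_distrib]
    _ = _ := by simp

end Selection

/-! ### Random words, list decoding regions and the rarity of close typical words. -/

section Coding

variable {S Y : Type*} [Fintype S] [MeasurableSpace Y]

theorem lintegral_mix_dirac [MeasurableSpace S] [MeasurableSingletonClass S] (p : S → ℝ)
    (f : S → ℝ≥0∞) : ∫⁻ s, f s ∂(mix Measure.dirac p) = ∑ s, ENNReal.ofReal (p s) * f s := by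
  simp [mix, lintegral_finsetSum_measure, lintegral_smul_measure]

theorem integral_mix_dirac [MeasurableSpace S] [MeasurableSingletonClass S] {p : S → ℝ}
    (hp : ∀ s, 0 < p s) (f : S → ℝ) : ∫ s, f s ∂(mix Measure.dirac p) = ∑ s, p s * f s := by
  rw [mix, integral_finsetSum_measure]
  · simp [ENNReal.toReal_ofReal (hp _).le]
  · exact fun s _ => Integrable.smul_measure (by simp) (by simp)

theorem mix_dirac_singleton [MeasurableSpace S] [MeasurableSingletonClass S] (p : S → ℝ) (s : S) :
    mix Measure.dirac p {s} = ENNReal.ofReal (p s) := by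
  classical
  simp [mix, Measure.finsetSum_apply, Set.indicator_apply]

/-- The empirical mean of a function of the letters of a random word is close to its mean. -/
theorem exists_pi_mix_dirac_deviation_le [MeasurableSpace S] [MeasurableSingletonClass S]
    {p : S → ℝ} (hp : ∀ s, 0 < p s) (hp1 : ∑ s, p s = 1) (f : S → ℝ) {c : ℝ} (hc : 0 < c) :
    ∃ v : ℝ, 0 ≤ v ∧ ∀ n : ℕ, 0 < n → Measure.pi (fun _ : Fin n => mix Measure.dirac p)
      {x | c * n ≤ |∑ i, f (x i) - n * ∑ s, p s * f s|} ≤ ENNReal.ofReal (v / n) := by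
  have := isProbabilityMeasure_mix (fun s => Measure.dirac s) (fun s => (hp s).le) hp1
  refine ⟨Var[f; mix Measure.dirac p] / c ^ 2, div_nonneg (variance_nonneg _ _) (sq_nonneg _),
    fun n hn => ?_⟩
  have hf : MemLp f 2 (mix Measure.dirac p) := by
    obtain ⟨C, hC⟩ := (Set.finite_range fun s => ‖f s‖).bddAbove
    exact MemLp.of_bound (measurable_of_finite f).aestronglyMeasurable C
      (ae_of_all _ fun s => hC ⟨s, rfl⟩)
  have h := measure_pi_sum_sub_integral_ge_le hn (fun _ => mix Measure.dirac p) (fun _ => f)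
    (fun _ => hf) (fun _ => le_rfl) hc
  rw [div_div]
  refine le_trans (le_of_eq ?_) h
  simp [integral_mix_dirac hp]

variable (V : S → Measure Y) [∀ s, IsProbabilityMeasure (V s)] {p : S → ℝ}

/-- The outputs that are likely under the codeword `c m` and under at most `L` codewords. -/
def listRegion (p : S → ℝ) {M n : ℕ} (θ : ℝ≥0∞) (L : ℕ) (c : Fin M → Fin n → S) (m : Fin M) :
    Set (Fin n → Y) :=
  {y | θ ≤ wordDens V p (c m) y ∧
    ∀ s : Finset (Fin M), (∀ m' ∈ s, θ ≤ wordDens V p (c m') y) → s.card ≤ L}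

omit [∀ s, IsProbabilityMeasure (V s)] in
theorem measurableSet_listRegion {M n : ℕ} (θ : ℝ≥0∞) (L : ℕ) (c : Fin M → Fin n → S)
    (m : Fin M) : MeasurableSet (listRegion V p θ L c m) := by
  have h : ∀ m', MeasurableSet {y | θ ≤ wordDens V p (c m') y} := fun m' =>
    measurableSet_le measurable_const (measurable_wordDens V _)
  have e : listRegion V p θ L c m = {y | θ ≤ wordDens V p (c m) y} ∩
      ⋂ s : Finset (Fin M), (⋂ m' ∈ s, {y | θ ≤ wordDens V p (c m') y})ᶜ ∪ {_y | s.card ≤ L} := by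
    ext y
    simp only [listRegion, Set.mem_ofPred_eq, Set.mem_inter_iff, Set.mem_iInter, Set.mem_union,
      Set.mem_compl_iff, imp_iff_not_or]
  rw [e]
  exact (h m).inter (MeasurableSet.iInter fun s =>
    (Finset.measurableSet_biInter s fun m' _ => h m').compl.union (MeasurableSet.const _))

/-- Outside the region either the density of the sent codeword is below `θ`, or at least `L` other
codewords reach `θ`; Markov's inequality applies to the number of the latter. -/
theorem pi_compl_listRegion_le {M n : ℕ} {θ : ℝ≥0∞} (h0 : θ ≠ 0) (ht : θ ≠ ⊤) {L : ℕ}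
    (hL : 0 < L) (c : Fin M → Fin n → S) (m : Fin M) :
    Measure.pi (fun i => V (c m i)) (listRegion V p θ L c m)ᶜ ≤
      Measure.pi (fun i => V (c m i)) {y | wordDens V p (c m) y < θ} +
      ∑ m', if m' = m then 0 else wordCrossDens V p (c m) (c m') / (θ * L) := by
  classical
  set ρ := Measure.pi fun i => V (c m i) with hρ
  set F : (Fin n → Y) → ℝ≥0∞ := fun y => ∑ m', if m' = m then 0 else
    {y | θ ≤ wordDens V p (c m') y}.indicator 1 y with hF
  have hms : ∀ m', MeasurableSet {y | θ ≤ wordDens V p (c m') y} := fun m' =>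
    measurableSet_le measurable_const (measurable_wordDens V _)
  have hFm' : ∀ m', Measurable fun y => if m' = m then (0 : ℝ≥0∞) else
      {y | θ ≤ wordDens V p (c m') y}.indicator 1 y := by
    intro m'
    by_cases h : m' = m
    · simp [h]
    · simpa [h] using measurable_one.indicator (hms m')
  have hFm : Measurable F := Finset.measurable_fun_sum _ fun m' _ => hFm' m'
  have hsub : (listRegion V p θ L c m)ᶜ ⊆ {y | wordDens V p (c m) y < θ} ∪ {y | (L : ℝ≥0∞) ≤ F y} := by
    intro y hy
    by_cases h1 : wordDens V p (c m) y < θ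
    · exact Or.inl h1
    right
    simp only [listRegion, Set.mem_compl_iff, Set.mem_ofPred_eq, not_and, not_forall,
      not_le] at hy
    obtain ⟨s, hs, hcard⟩ := hy (not_lt.1 h1)
    -- The overfull set has more than `L` elements, so removing `m` leaves at least `L`.
    have h2 : L ≤ (s.erase m).card := by
      have := Finset.pred_card_le_card_erase (s := s) (a := m); omega
    calc (L : ℝ≥0∞) ≤ (s.erase m).card := by exact_mod_cast h2
      _ = ∑ m' ∈ s.erase m, 1 := by simp
      _ ≤ ∑ m' ∈ s.erase m, (if m' = m then 0 else
            {y | θ ≤ wordDens V p (c m') y}.indicator 1 y) := by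
          refine Finset.sum_le_sum fun m' hm' => ?_
          rw [Finset.mem_erase] at hm'
          rw [if_neg hm'.1, Set.indicator_of_mem
            (show y ∈ {y | θ ≤ wordDens V p (c m') y} from hs m' hm'.2)]
          rfl
      _ ≤ F y := Finset.sum_le_sum_of_subset (Finset.subset_univ _)
  refine (measure_mono hsub).trans ((measure_union_le _ _).trans (by
    gcongr
    have hL0 : (L : ℝ≥0∞) ≠ 0 := by exact_mod_cast hL.ne'
    refine (meas_ge_le_lintegral_div hFm.aemeasurable hL0 (by simp)).trans ?_
    rw [lintegral_finsetSum _ fun m' _ => hFm' m', ENNReal.div_eq_inv_mul, Finset.mul_sum]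
    refine Finset.sum_le_sum fun m' _ => ?_
    by_cases h : m' = m
    · simp [h]
    · simp only [h, if_false]
      rw [lintegral_indicator_one (hms m')]
      calc _ ≤ (L : ℝ≥0∞)⁻¹ * (wordCrossDens V p (c m) (c m') / θ) := by
            gcongr; exact pi_wordDens_ge_le V _ _ h0 ht
        _ = _ := by
            rw [ENNReal.div_eq_inv_mul, ENNReal.div_eq_inv_mul, ← mul_assoc,
              ENNReal.mul_inv (Or.inl h0) (Or.inl ht), mul_comm θ⁻¹]))

theorem lintegral_wordCrossDens [MeasurableSpace S] [MeasurableSingletonClass S]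
    (hp : ∀ s, 0 < p s) {n : ℕ} (x : Fin n → S) :
    ∫⁻ x', wordCrossDens V p x x' ∂(Measure.pi fun _ : Fin n => mix Measure.dirac p) = 1 := by
  refine (lintegral_pi_prod (fun _ => mix Measure.dirac p) (fun i s => crossDens V p (x i) s)
    fun _ => measurable_of_finite _).trans (Finset.prod_eq_one fun i _ => ?_)
  rw [lintegral_mix_dirac, sum_crossDens V hp]

/-- The probability that a random word is typical and close to a given word. -/
theorem pi_mix_dirac_hammingBall_le [DecidableEq S] [MeasurableSpace S]
    [MeasurableSingletonClass S] (hp : ∀ s, 0 < p s) (hp1 : ∑ s, p s = 1) {τ : ℝ} (hτ : 0 < τ) :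
    ∃ η : ℝ, 0 < η ∧ ∀ (n : ℕ) (x : Fin n → S) (h : ℝ),
      Measure.pi (fun _ : Fin n => mix Measure.dirac p)
        {x' | n * h ≤ ∑ i, -Real.log (p (x' i)) ∧ (hammingDist x x' : ℝ) < η * n} ≤
      ENNReal.ofReal (Real.exp (-(n * (h - 2 * τ)))) := by
  have := isProbabilityMeasure_mix (fun s => Measure.dirac s) (fun s => (hp s).le) hp1
  -- With this `s` the generating function `(1 + |S| s) ^ n` is at most `exp (τ n)`. The radius `τ /
  -- -log s` chosen below makes `s ^ (η n) = exp (-τ n)`, so the ball has at most `exp (2 τ n)`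
  -- words, each of probability at most `exp (-n h)` if typical.
  obtain ⟨s, hs0, hs1, hsτ⟩ : ∃ s : ℝ, 0 < s ∧ s < 1 ∧ Fintype.card S * s ≤ τ := by
    refine ⟨min (1 / 2) (τ / (Fintype.card S + 1)), by positivity,
      (min_le_left _ _).trans_lt (by norm_num), ?_⟩
    calc (Fintype.card S : ℝ) * min (1 / 2) (τ / (Fintype.card S + 1)) ≤
          (Fintype.card S + 1) * (τ / (Fintype.card S + 1)) := by
          gcongr
          · linarith
          · exact min_le_right _ _
      _ = τ := by field_simp
  have hlog : 0 < -Real.log s := by linarith [Real.log_neg hs0 hs1]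
  refine ⟨τ / -Real.log s, by positivity, fun n x h => ?_⟩
  set η := τ / -Real.log s
  set B := Finset.univ.filter fun x' => (hammingDist x x' : ℝ) < η * n with hB
  have hcard : (B.card : ℝ) ≤ Real.exp (2 * τ * n) := by
    have h1 := card_hammingBall_mul_le x (r := η * n) hs0 hs1.le
    have h2 : s ^ (η * n) = Real.exp (-(τ * n)) := by
      rw [Real.rpow_def_of_pos hs0]
      congr 1
      have : Real.log s ≠ 0 := (Real.log_neg hs0 hs1).ne
      simp only [η]
      field_simp
    have h3 : (1 + Fintype.card S * s) ^ n ≤ Real.exp (τ * n) := by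
      rw [mul_comm τ, Real.exp_nat_mul]
      gcongr
      linarith [Real.add_one_le_exp τ]
    rw [h2] at h1
    have h4 := h1.trans h3
    rw [Real.exp_neg, ← div_eq_mul_inv, div_le_iff₀ (Real.exp_pos _), ← Real.exp_add] at h4
    rwa [← add_mul, ← two_mul] at h4
  set A := B.filter fun x' => n * h ≤ ∑ i, -Real.log (p (x' i)) with hA
  have hset : {x' : Fin n → S | n * h ≤ ∑ i, -Real.log (p (x' i)) ∧
      (hammingDist x x' : ℝ) < η * n} = (A : Set (Fin n → S)) := by
    ext x'; simp [hA, hB, and_comm]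
  rw [hset, ← sum_measure_singleton]
  calc _ ≤ ∑ _x' ∈ A, ENNReal.ofReal (Real.exp (-(n * h))) := by
        refine Finset.sum_le_sum fun x' hx' => ?_
        rw [Measure.pi_singleton]
        simp only [mix_dirac_singleton]
        rw [← ENNReal.ofReal_prod_of_nonneg fun i _ => (hp _).le]
        refine ENNReal.ofReal_le_ofReal ?_
        rw [← Real.log_le_iff_le_exp (Finset.prod_pos fun i _ => hp _),
          Real.log_prod fun i _ => (hp _).ne']
        have := (Finset.mem_filter.1 hx').2
        rw [Finset.sum_neg_distrib] at this
        linarith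
    _ = ENNReal.ofReal (A.card * Real.exp (-(n * h))) := by
        rw [Finset.sum_const, nsmul_eq_mul, ENNReal.ofReal_mul (by positivity),
          ENNReal.ofReal_natCast]
    _ ≤ _ := by
        refine ENNReal.ofReal_le_ofReal ?_
        calc (A.card : ℝ) * Real.exp (-(n * h)) ≤ Real.exp (2 * τ * n) * Real.exp (-(n * h)) := by
              gcongr
              exact le_trans (by exact_mod_cast Finset.card_filter_le _ _) hcard
          _ = _ := by rw [← Real.exp_add]; congr 1; ring

end Coding

/-! ### Existence of list codes with typical, well separated codewords. -/

section ListCode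

variable {S Y : Type*} [Fintype S] [MeasurableSpace Y]

theorem tendsto_exp_neg_natCast_mul {τ : ℝ} (hτ : 0 < τ) :
    Tendsto (fun n : ℕ => Real.exp (-(n * τ))) atTop (𝓝 0) :=
  Real.tendsto_exp_neg_atTop_nhds_zero.comp
    (tendsto_natCast_atTop_atTop.atTop_mul_const hτ)

theorem tendsto_const_div_mul_natCast (v c : ℝ) :
    Tendsto (fun n : ℕ => v / (c * n)) atTop (𝓝 0) := by
  simpa [div_div] using tendsto_const_div_atTop_nhds_zero_nat (v / c)

/-- List codes whose codewords are typical and pairwise far apart. -/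
theorem exists_listCode [DecidableEq S] (V : S → Measure Y) [∀ s, IsProbabilityMeasure (V s)]
    {p : S → ℝ} (hp : ∀ s, 0 < p s) (hp1 : ∑ s, p s = 1) {ρ₁ ρ₂ : ℝ}
    (hρ : ρ₁ < ∑ s, p s * -Real.log (p s))
    (hI : ρ₁ - ρ₂ < ∑ s, p s * (klDiv (V s) (mix V p)).toReal)
    (u : S → ℝ) {δ : ℝ} (hδ : 0 < δ) (M L : ℕ → ℕ)
    (hM : ∀ᶠ n : ℕ in atTop, (M n : ℝ) ≤ 2 * Real.exp (n * ρ₁))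
    (hL : ∀ᶠ n : ℕ in atTop, Real.exp (n * ρ₂) ≤ L n) :
    ∃ η : ℝ, 0 < η ∧ ∀ γ : ℝ, 0 < γ → ∀ᶠ n : ℕ in atTop,
      ∃ (c : Fin (M n) → Fin n → S) (B : Fin (M n) → Set (Fin n → Y)),
        (∀ m, MeasurableSet (B m)) ∧
        (∀ y (s : Finset (Fin (M n))), (∀ m ∈ s, y ∈ B m) → s.card ≤ L n) ∧
        (∀ m, Measure.pi (fun i => V (c m i)) (B m)ᶜ ≤ ENNReal.ofReal γ) ∧
        (∀ m, ∑ i, u (c m i) ≤ n * (∑ s, p s * u s + δ)) ∧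
        ∀ m m', m ≠ m' → η * n ≤ hammingDist (c m) (c m') := by
  classical
  let _ : MeasurableSpace S := ⊤
  have : MeasurableSingletonClass S := ⟨fun _ => trivial⟩
  have := isProbabilityMeasure_mix (fun s => Measure.dirac s) (fun s => (hp s).le) hp1
  set d : S → ℝ := fun s => (klDiv (V s) (mix V p)).toReal with hd
  -- A quarter of each gap: `κ` is spent once in `θ`, once on typicality and once on the Chebyshev
  -- margin; `τ` once on typicality and twice on the size of the ball, and at least one share is
  -- left for exponential decay.
  set κ := (∑ s, p s * d s - (ρ₁ - ρ₂)) / 4 with hκ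
  set τ := (∑ s, p s * -Real.log (p s) - ρ₁) / 4 with hτ
  have hκ0 : 0 < κ := by rw [hκ]; linarith
  have hτ0 : 0 < τ := by rw [hτ]; linarith
  obtain ⟨η, hη, hball⟩ := pi_mix_dirac_hammingBall_le hp hp1 hτ0
  obtain ⟨v₁, hv₁, hu⟩ := exists_pi_mix_dirac_deviation_le hp hp1 u hδ
  obtain ⟨v₂, hv₂, hh⟩ := exists_pi_mix_dirac_deviation_le hp hp1 (fun s => -Real.log (p s)) hτ0
  obtain ⟨v₃, hv₃, hdd⟩ := exists_pi_mix_dirac_deviation_le hp hp1 d hκ0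
  obtain ⟨v, hv⟩ := exists_pi_wordDens_lt_le V hp hp1
  refine ⟨η, hη, fun γ hγ => ?_⟩
  -- After expurgation every penalty is at most `2 ε`. This is below one, which forces the 0-1
  -- penalties to vanish, and at most `γ / 2`, which bounds the list overflow.
  set ε : ℝ := min (γ / 4) (1 / 4) with hε
  have hε0 : 0 < ε := by positivity
  have hlim : Tendsto (fun n : ℕ => (v₁ + v₂ + v₃) / n +
      4 * (Real.exp (-(n * τ)) + Real.exp (-(n * κ)))) atTop (𝓝 0) := by
    have := (tendsto_const_div_atTop_nhds_zero_nat (v₁ + v₂ + v₃)).add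
      (((tendsto_exp_neg_natCast_mul hτ0).add (tendsto_exp_neg_natCast_mul hκ0)).const_mul 4)
    simpa using this
  filter_upwards [hlim.eventually_le_const hε0,
    (tendsto_const_div_mul_natCast v (κ ^ 2)).eventually_le_const (half_pos hγ),
    eventually_gt_atTop 0, hM, hL] with n h1 h2 hn hMn hLn
  set Q := Measure.pi fun _ : Fin n => mix (S := S) Measure.dirac p with hQ
  set T : Set (Fin n → S) := {x | |∑ i, u (x i) - n * ∑ s, p s * u s| < δ * n ∧
    |∑ i, -Real.log (p (x i)) - n * ∑ s, p s * -Real.log (p s)| < τ * n ∧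
    |∑ i, d (x i) - n * ∑ s, p s * d s| < κ * n} with hT
  set θ : ℝ≥0∞ := ENNReal.ofReal (Real.exp (n * (ρ₁ - ρ₂ + κ))) with hθ
  have hθ0 : θ ≠ 0 := by simpa [hθ] using Real.exp_pos _
  have hθt : θ ≠ ⊤ := ENNReal.ofReal_ne_top
  have hL0 : 0 < L n := by
    have := (Real.exp_pos _).trans_le hLn
    exact_mod_cast this
  set f : (Fin n → S) → ℝ≥0∞ := Tᶜ.indicator 1 with hf
  -- The first term forbids close typical pairs, the second is the Markov bound for a false
  -- candidate. Typicality is asked of both words to keep `g` symmetric.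
  set g : (Fin n → S) → (Fin n → S) → ℝ≥0∞ := fun x x' =>
    (if x ∈ T ∧ x' ∈ T ∧ (hammingDist x x' : ℝ) < η * n then 1 else 0) +
      wordCrossDens V p x x' / (θ * L n) with hg
  have hfa : ∫⁻ x, f x ∂Q ≤ ENNReal.ofReal ((v₁ + v₂ + v₃) / n) := by
    rw [hf, lintegral_indicator_one (Set.toFinite _).measurableSet, add_div, add_div,
      ENNReal.ofReal_add (by positivity) (by positivity),
      ENNReal.ofReal_add (by positivity) (by positivity)]
    have hsub : Tᶜ ⊆ {x | δ * n ≤ |∑ i, u (x i) - n * ∑ s, p s * u s|} ∪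
        {x | τ * n ≤ |∑ i, -Real.log (p (x i)) - n * ∑ s, p s * -Real.log (p s)|} ∪
        {x | κ * n ≤ |∑ i, d (x i) - n * ∑ s, p s * d s|} := by
      intro x hx
      by_contra hcon
      simp only [Set.mem_union, Set.mem_ofPred_eq, not_or, not_le] at hcon
      exact hx ⟨hcon.1.1, hcon.1.2, hcon.2⟩
    refine (measure_mono hsub).trans ((measure_union_le _ _).trans ?_)
    exact add_le_add ((measure_union_le _ _).trans (add_le_add (hu n hn) (hh n hn))) (hdd n hn)
  have hgb : ∀ x, ∫⁻ x', g x x' ∂Q ≤ ENNReal.ofReal (Real.exp (-(n * (ρ₁ + τ)))) +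
      ENNReal.ofReal (Real.exp (-(n * (ρ₁ + κ)))) := by
    intro x
    rw [hg, lintegral_add_left (measurable_of_finite _)]
    refine add_le_add ?_ ?_
    · have hb := hball n x (∑ s, p s * -Real.log (p s) - τ)
      have e : ∑ s, p s * -Real.log (p s) - τ - 2 * τ = ρ₁ + τ := by rw [hτ]; ring
      rw [e] at hb
      refine le_trans ?_ hb
      rw [← lintegral_indicator_one (Set.toFinite _).measurableSet]
      refine lintegral_mono fun x' => ?_
      dsimp only
      split_ifs with h
      · rw [Set.indicator_of_mem]
        · rfl
        · refine ⟨?_, h.2.2⟩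
          have := (abs_lt.1 h.2.1.2.1).1
          linarith
      · exact zero_le
    · simp_rw [ENNReal.div_eq_inv_mul]
      rw [lintegral_const_mul _ (measurable_of_finite _), lintegral_wordCrossDens V hp, mul_one,
        Real.exp_neg, ENNReal.ofReal_inv_of_pos (Real.exp_pos _), ENNReal.inv_le_inv, hθ,
        ← ENNReal.ofReal_natCast, ← ENNReal.ofReal_mul (Real.exp_pos _).le]
      refine ENNReal.ofReal_le_ofReal ?_
      calc Real.exp (n * (ρ₁ + κ)) = Real.exp (n * (ρ₁ - ρ₂ + κ)) * Real.exp (n * ρ₂) := by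
            rw [← Real.exp_add]; congr 1; ring
        _ ≤ _ := by gcongr
  have hsymm : ∀ x x', g x x' = g x' x := by
    intro x x'
    simp only [hg, wordCrossDens_comm V hp x x', hammingDist_comm x x']
    congr 2
    exact propext ⟨fun h => ⟨h.2.1, h.1, h.2.2⟩, fun h => ⟨h.2.1, h.1, h.2.2⟩⟩
  obtain ⟨c, hc⟩ := exists_codewords Q f g (measurable_of_finite _)
    (fun _ => measurable_of_finite _) hsymm hfa hgb (M n) (ε := ENNReal.ofReal ε)
    (by simpa using hε0) ENNReal.ofReal_ne_top (by
      rw [← ENNReal.ofReal_add (Real.exp_pos _).le (Real.exp_pos _).le,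
        ← ENNReal.ofReal_natCast, show (2 : ℝ≥0∞) = ENNReal.ofReal 2 by simp,
        ← ENNReal.ofReal_mul zero_le_two, ← ENNReal.ofReal_mul (by positivity),
        ← ENNReal.ofReal_add (by positivity) (by positivity)]
      refine ENNReal.ofReal_le_ofReal (le_trans ?_ h1)
      refine add_le_add le_rfl ?_
      calc 2 * (M n : ℝ) * (Real.exp (-(n * (ρ₁ + τ))) + Real.exp (-(n * (ρ₁ + κ)))) ≤
          2 * (2 * Real.exp (n * ρ₁)) *
            (Real.exp (-(n * (ρ₁ + τ))) + Real.exp (-(n * (ρ₁ + κ)))) := by gcongr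
        _ = 4 * (Real.exp (n * ρ₁) * Real.exp (-(n * (ρ₁ + τ))) +
            Real.exp (n * ρ₁) * Real.exp (-(n * (ρ₁ + κ)))) := by ring
        _ = _ := by
          rw [← Real.exp_add, ← Real.exp_add]
          ring_nf)
  have h2ε : 2 * ENNReal.ofReal ε = ENNReal.ofReal (2 * ε) := by
    rw [ENNReal.ofReal_mul zero_le_two]; simp
  have hlt1 : 2 * ENNReal.ofReal ε < 1 := by
    rw [h2ε, ENNReal.ofReal_lt_one]
    linarith [min_le_right (γ / 4) (1 / 4 : ℝ)]
  -- An atypical codeword would cost one by itself.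
  have hcT : ∀ m, c m ∈ T := by
    intro m
    by_contra hm
    have h3 := (le_self_add.trans (hc m)).trans_lt hlt1
    rw [hf, Set.indicator_of_mem (show c m ∈ Tᶜ from hm)] at h3
    exact lt_irrefl _ h3
  refine ⟨c, listRegion V p θ (L n) c, fun m => measurableSet_listRegion V θ (L n) c m,
    fun y s hs => ?_, fun m => ?_, fun m => ?_, fun m m' hmm => ?_⟩
  · rcases s.eq_empty_or_nonempty with rfl | ⟨m, hm⟩
    · simp
    · exact (hs m hm).2 s fun m' hm' => (hs m' hm').1
  · refine (pi_compl_listRegion_le V hθ0 hθt hL0 c m).trans ?_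
    have h3 := hv n hn (c m) (ρ₁ - ρ₂ + κ) κ hκ0 (by
      have := (abs_lt.1 (hcT m).2.2).1
      have e : ρ₁ - ρ₂ + κ + κ = ∑ s, p s * d s - 2 * κ := by rw [hκ]; ring
      have hn' : (0 : ℝ) < n := Nat.cast_pos.2 hn
      rw [e]
      nlinarith [mul_pos hκ0 hn'])
    have h4 : ∑ m', (if m' = m then 0 else wordCrossDens V p (c m) (c m') / (θ * L n)) ≤
        2 * ENNReal.ofReal ε := by
      refine le_trans (le_trans (Finset.sum_le_sum fun m' _ => ?_) le_add_self) (hc m)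
      split_ifs
      · exact le_rfl
      · exact le_add_self
    calc _ ≤ ENNReal.ofReal (γ / 2) + ENNReal.ofReal (γ / 2) := by
          refine add_le_add (h3.trans (ENNReal.ofReal_le_ofReal h2)) (h4.trans ?_)
          rw [h2ε]
          exact ENNReal.ofReal_le_ofReal (by linarith [min_le_left (γ / 4) (1 / 4 : ℝ)])
      _ = _ := by
          rw [← ENNReal.ofReal_add (by positivity) (by positivity), add_halves]
  · have := (abs_lt.1 (hcT m).1).2
    linarith
  -- Two close codewords, both typical, would cost one by themselves.
  · by_contra hlt
    have h3 : g (c m) (c m') ≤ 2 * ENNReal.ofReal ε := by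
      refine le_trans (le_trans ?_ le_add_self) (hc m)
      have := Finset.single_le_sum
        (f := fun m' => if m' = m then 0 else g (c m) (c m')) (fun _ _ => zero_le)
        (Finset.mem_univ m')
      simpa [hmm.symm] using this
    have h4 := (le_self_add.trans h3).trans_lt hlt1
    rw [if_pos ⟨hcT m, hcT m', not_le.1 hlt⟩] at h4
    exact lt_irrefl _ h4

end ListCode

/-! ### Verification of the input word -/

section Verification

variable {A Y : Type*} [MeasurableSpace Y]

/-- For `s ≥ 1` the logarithm is nonnegative while `-1 / t` is negative. This turns the exponent
condition of (W3) into a contraction factor. -/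
theorem lt_one_of_neg_mul_log2_pos {t : ℝ} (ht : 0 < t) {s : ℝ≥0∞}
    (h : 0 < ((-1 / t : ℝ) : EReal) * log2 s) : s < 1 := by
  by_contra hs
  have h1 : 0 ≤ ENNReal.log s := by
    rw [← ENNReal.log_one]; exact ENNReal.log_monotone (not_lt.1 hs)
  have h2 : 0 ≤ log2 s := EReal.div_nonneg h1 (by exact_mod_cast (Real.log_pos one_lt_two).le)
  have h3 : ((-1 / t : ℝ) : EReal) ≤ 0 := by
    exact_mod_cast div_nonpos_of_nonpos_of_nonneg (by norm_num) ht.le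
  rcases EReal.mul_pos_iff.1 h with ⟨h4, _⟩ | ⟨_, h4⟩
  · exact h4.not_ge h3
  · exact h4.not_ge h2

theorem CondW3.exists_bounds [MetricSpace A] {W : A → Measure Y}
    [∀ a, IsProbabilityMeasure (W a)] {X : Finset A} (h : CondW3 W X) :
    ∃ (ξ : A → Y → ℝ) (v : ℝ), (∀ a, Measurable (ξ a)) ∧ (∀ a, MemLp (ξ a) 2 (W a)) ∧
      (∀ a, ∫ y, ξ a y ∂(W a) = 0) ∧ (∀ a, Var[ξ a; W a] ≤ v) ∧
      ∀ r : ℝ, 0 < r → ∃ q : ℝ, 0 < q ∧ q < 1 ∧ ∀ x ∈ X, ∀ x', r ≤ dist x x' →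
        ∫⁻ y, ENNReal.ofReal ((2 : ℝ) ^ ((1 / 4 : ℝ) * (ξ x y - ξ x' y))) ∂(W x') ≤
          ENNReal.ofReal q := by
  obtain ⟨ξ, hm, hi, hz, hV⟩ := h
  have hle : ∀ a, evariance (ξ a) (W a) ≤ ⨆ a, evariance (ξ a) (W a) := le_iSup _
  refine ⟨ξ, (⨆ a, evariance (ξ a) (W a)).toReal, hm, fun a => ?_, fun a => (hi a).2,
    fun a => ENNReal.toReal_mono hV.ne (hle a), fun r hr => ?_⟩
  · exact (evariance_lt_top_iff_memLp (hm a).aestronglyMeasurable).1 ((hle a).trans_lt hV)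
  · have hs := lt_one_of_neg_mul_log2_pos (by norm_num)
      (hz r hr (1 / 4) ⟨by norm_num, by norm_num⟩)
    set s := ⨆ x ∈ X, ⨆ x' : A, ⨆ _ : r ≤ dist x x',
      ∫⁻ y, ENNReal.ofReal ((2 : ℝ) ^ ((1 / 4 : ℝ) * (ξ x y - ξ x' y))) ∂(W x') with hs'
    -- The supremum can be zero; the maximum with `1 / 2` keeps `q` positive so that its logarithm
    -- is usable.
    refine ⟨max (1 / 2) s.toReal, by positivity, max_lt (by norm_num) ?_, fun x hx x' hd => ?_⟩
    · simpa using (ENNReal.toReal_lt_toReal hs.ne_top ENNReal.one_ne_top).2 hs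
    · calc _ ≤ s := by
            rw [hs']
            exact le_iSup₂_of_le x hx (le_iSup₂_of_le x' hd le_rfl)
        _ = ENNReal.ofReal s.toReal := (ENNReal.ofReal_toReal hs.ne_top).symm
        _ ≤ _ := ENNReal.ofReal_le_ofReal (le_max_right _ _)

theorem wordDist_sum_lt_le {W : A → Measure Y} [∀ a, IsProbabilityMeasure (W a)]
    {ξ : A → Y → ℝ} {v : ℝ} (hL : ∀ a, MemLp (ξ a) 2 (W a))
    (h0 : ∀ a, ∫ y, ξ a y ∂(W a) = 0) (hv : ∀ a, Var[ξ a; W a] ≤ v) {κ : ℝ} (hκ : 0 < κ)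
    {n : ℕ} (hn : 0 < n) (x : Fin n → A) :
    wordDist W x {y | κ * n ≤ |∑ i, ξ (x i) (y i)|} ≤ ENNReal.ofReal (v / (κ ^ 2 * n)) := by
  have h := measure_pi_sum_sub_integral_ge_le hn (fun i => W (x i)) (fun i => ξ (x i))
    (fun i => hL _) (fun i => hv _) hκ
  simpa [h0, wordDist] using h

/-- A test on the output word that accepts the honest input word and rejects every input word
that is far from it. -/
theorem CondW3.exists_verification [MetricSpace A] {W : A → Measure Y}
    [∀ a, IsProbabilityMeasure (W a)] {X : Finset A} (h : CondW3 W X) {β r : ℝ} (hβ : 0 < β)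
    (hr : 0 < r) :
    ∃ (ξ : A → Y → ℝ) (κ : ℝ) (e : ℕ → ℝ≥0∞), (∀ a, Measurable (ξ a)) ∧
      Tendsto e atTop (𝓝 0) ∧ ∀ n : ℕ, 0 < n → ∀ x : Fin n → A,
        wordDist W x {y | -(κ * n) ≤ ∑ i, ξ (x i) (y i)}ᶜ ≤ e n ∧
        ∀ x' : Fin n → A, (∀ i, x i ∈ X) →
          β * n ≤ (Finset.univ.filter fun i => r ≤ dist (x i) (x' i)).card →
          wordDist W x' {y | -(κ * n) ≤ ∑ i, ξ (x i) (y i)} ≤ e n := by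
  obtain ⟨ξ, v, hm, hL, h0, hv, hq⟩ := h.exists_bounds
  obtain ⟨q, hq0, hq1, hqr⟩ := hq r hr
  have hlq : Real.log q < 0 := Real.log_neg hq0 hq1
  have hl2 : 0 < Real.log 2 := Real.log_pos one_lt_two
  -- The exponential moment is at most `q ^ (β n) = 2 ^ (-κ n)`, while the event to be excluded has
  -- threshold `2 ^ (-κ n / 2)`, so Markov's inequality leaves half the exponent.
  set κ := β * -Real.log q / Real.log 2 with hκ
  have hκ0 : 0 < κ := div_pos (mul_pos hβ (by linarith)) hl2
  refine ⟨ξ, κ, fun n => ENNReal.ofReal (v / (κ ^ 2 * n)) +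
    ENNReal.ofReal (Real.exp (-(n * (β * -Real.log q / 2)))), hm, ?_, fun n hn x => ⟨?_, ?_⟩⟩
  · have h1 := ENNReal.tendsto_ofReal (tendsto_const_div_mul_natCast v (κ ^ 2))
    have h2 := ENNReal.tendsto_ofReal (tendsto_exp_neg_natCast_mul
      (τ := β * -Real.log q / 2) (by have := mul_pos hβ (neg_pos.2 hlq); linarith))
    simpa using h1.add h2
  · refine le_trans (measure_mono fun y hy => ?_)
      ((wordDist_sum_lt_le hL h0 hv hκ0 hn x).trans le_self_add)
    simp only [Set.mem_compl_iff, Set.mem_ofPred_eq, not_le] at hy ⊢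
    exact le_trans (by linarith) (neg_le_abs _)
  · intro x' hx hcard
    set F : (Fin n → Y) → ℝ≥0∞ := fun y => ∏ i,
      ENNReal.ofReal ((2 : ℝ) ^ ((1 / 4 : ℝ) * (ξ (x i) (y i) - ξ (x' i) (y i)))) with hF
    have hFm : ∀ i, Measurable fun y : Y =>
        ENNReal.ofReal ((2 : ℝ) ^ ((1 / 4 : ℝ) * (ξ (x i) y - ξ (x' i) y))) := fun i =>
      ((((hm _).sub (hm _)).const_mul _).const_pow _).ennreal_ofReal
    have hFmeas : Measurable F := Finset.measurable_fun_prod _ fun i _ =>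
      (hFm i).comp (measurable_pi_apply i)
    have hint : ∫⁻ y, F y ∂(wordDist W x') ≤ ENNReal.ofReal (Real.exp (n * (β * Real.log q))) := by
      rw [wordDist, hF, lintegral_pi_prod (fun i => W (x' i)) _ hFm]
      calc _ ≤ ∏ i, (if r ≤ dist (x i) (x' i) then ENNReal.ofReal q else 1) := by
            refine Finset.prod_le_prod' fun i _ => ?_
            split_ifs with hd
            · exact hqr _ (hx i) _ hd
            -- Positions that are not `r`-far cost at most a factor one: equal letters give exponent
            -- zero, and distinct letters fall under (W3) with their own distance as radius.
            · rcases eq_or_ne (x i) (x' i) with he | he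
              · simp [he]
              · obtain ⟨q', _, hq1', hqr'⟩ := hq _ (dist_pos.2 he)
                exact (hqr' _ (hx i) _ le_rfl).trans
                  (by simpa using ENNReal.ofReal_le_ofReal hq1'.le)
        _ = ENNReal.ofReal (q ^ (Finset.univ.filter fun i => r ≤ dist (x i) (x' i)).card) := by
            rw [Finset.prod_ite]
            simp [ENNReal.ofReal_pow hq0.le]
        _ ≤ _ := by
            refine ENNReal.ofReal_le_ofReal ?_
            rw [← Real.rpow_natCast, Real.rpow_def_of_pos hq0]
            refine Real.exp_le_exp.2 ?_
            nlinarith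
    -- If the word `x` is accepted and the sum for the true input `x'` is below `κ n`, the
    -- difference of the sums exceeds `-2 κ n`; the factor `1 / 4` turns this into `-κ n / 2`.
    have hsub : {y : Fin n → Y | -(κ * n) ≤ ∑ i, ξ (x i) (y i)} ⊆
        {y | κ * n ≤ |∑ i, ξ (x' i) (y i)|} ∪
          {y | ENNReal.ofReal ((2 : ℝ) ^ (-(κ * n / 2))) ≤ F y} := by
      intro y hy
      simp only [Set.mem_union, Set.mem_ofPred_eq] at hy ⊢
      by_cases h1 : κ * n ≤ |∑ i, ξ (x' i) (y i)|
      · exact Or.inl h1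
      right
      simp only [hF]
      rw [← ENNReal.ofReal_prod_of_nonneg fun i _ => by positivity,
        ← Real.rpow_sum_of_pos zero_lt_two, ← Finset.mul_sum, Finset.sum_sub_distrib]
      refine ENNReal.ofReal_le_ofReal (Real.rpow_le_rpow_of_exponent_le one_le_two ?_)
      have := (abs_lt.1 (not_le.1 h1)).2
      linarith
    refine (measure_mono hsub).trans ((measure_union_le _ _).trans
      (add_le_add (wordDist_sum_lt_le hL h0 hv hκ0 hn x') ?_))
    refine (meas_ge_le_lintegral_div hFmeas.aemeasurable
      (by simp only [ne_eq, ENNReal.ofReal_eq_zero, not_le]; positivity)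
      ENNReal.ofReal_ne_top).trans ?_
    calc _ ≤ ENNReal.ofReal (Real.exp (n * (β * Real.log q))) /
          ENNReal.ofReal ((2 : ℝ) ^ (-(κ * n / 2))) := by gcongr
      _ = _ := by
          rw [← ENNReal.ofReal_div_of_pos (by positivity), Real.rpow_def_of_pos zero_lt_two,
            ← Real.exp_sub]
          congr 2
          rw [hκ]
          field_simp
          ring

end Verification

/-! ### Divergences of product distributions -/

section Divergence

variable {Y : Type*} [MeasurableSpace Y]

theorem klDiv_pi {n : ℕ} (σ ρ : Fin n → Measure Y) [∀ i, IsProbabilityMeasure (σ i)]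
    [∀ i, IsProbabilityMeasure (ρ i)] (h : ∀ i, σ i ≪ ρ i)
    (hi : ∀ i, Integrable (llr (σ i) (ρ i)) (σ i)) :
    klDiv (Measure.pi σ) (Measure.pi ρ) = ∑ i, klDiv (σ i) (ρ i) := by
  have hac := pi_absolutelyContinuous ρ σ h
  have hpos : ∀ i, ∀ᵐ y ∂(σ i), 0 < (σ i).rnDeriv (ρ i) y ∧ (σ i).rnDeriv (ρ i) y < ⊤ := fun i =>
    (Measure.rnDeriv_pos (h i)).and ((h i).ae_le (Measure.rnDeriv_lt_top _ _))
  have hllr : llr (Measure.pi σ) (Measure.pi ρ) =ᵐ[Measure.pi σ]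
      fun y => ∑ i, llr (σ i) (ρ i) (y i) := by
    filter_upwards [hac.ae_le (rnDeriv_pi ρ σ h),
      ae_pi_of_ae σ hpos] with y h1 h2
    simp only [llr, h1]
    rw [ENNReal.toReal_prod, Real.log_prod]
    exact fun i _ => (ENNReal.toReal_pos (h2 i).1.ne' (h2 i).2.ne).ne'
  have hic : ∀ i, Integrable (fun y : Fin n → Y => llr (σ i) (ρ i) (y i)) (Measure.pi σ) :=
    fun i => (measurePreserving_eval σ i).integrable_comp_of_integrable (hi i)
  have hint : Integrable (fun y => ∑ i, llr (σ i) (ρ i) (y i)) (Measure.pi σ) :=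
    integrable_finsetSum _ fun i _ => hic i
  have hint' := hint.congr hllr.symm
  rw [← ENNReal.ofReal_toReal (klDiv_ne_top hac hint'),
    toReal_klDiv_of_measure_eq hac (by simp), integral_congr_ae hllr,
    integral_finsetSum _ fun i _ => hic i]
  have e : ∀ i, ∫ y, llr (σ i) (ρ i) (y i) ∂(Measure.pi σ) = (klDiv (σ i) (ρ i)).toReal :=
    fun i => by
      rw [integral_comp_eval (hi i).1, toReal_klDiv_of_measure_eq (h i) (by simp)]
  simp_rw [e]
  rw [ENNReal.ofReal_sum_of_nonneg fun i _ => ENNReal.toReal_nonneg]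
  exact Finset.sum_congr rfl fun i _ => ENNReal.ofReal_toReal (klDiv_ne_top (h i) (hi i))

/-- The integral of a power of the quotient of the densities, as in the Rényi divergence. -/
def renyiIntegral (ref : Measure Y) (α : ℝ) (P Q : Measure Y) : ℝ≥0∞ :=
  ∫⁻ y, (P.rnDeriv ref y / Q.rnDeriv ref y) ^ (α - 1) ∂P

theorem renyiIntegral_pi {n : ℕ} (μ : Measure Y) [SigmaFinite μ] {α : ℝ} (hα : 1 < α)
    (σ : Fin n → Measure Y) [∀ i, IsProbabilityMeasure (σ i)] (hσ : ∀ i, σ i ≪ μ)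
    (Q : Measure Y) [IsProbabilityMeasure Q] (hQ : Q ≪ μ) :
    renyiIntegral (Measure.pi fun _ => μ) α (Measure.pi σ) (Measure.pi fun _ => Q) =
      ∏ i, renyiIntegral μ α (σ i) Q := by
  have hac := pi_absolutelyContinuous (fun _ => μ) σ hσ
  have hac' : ∀ i, ∀ᵐ y ∂(σ i), Q.rnDeriv μ y < ⊤ := fun i =>
    (hσ i).ae_le (Measure.rnDeriv_lt_top _ _)
  rw [renyiIntegral, lintegral_congr_ae (g := fun y => ∏ i,
    ((σ i).rnDeriv μ (y i) / Q.rnDeriv μ (y i)) ^ (α - 1))]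
  · exact lintegral_pi_prod σ _ fun i =>
      ((Measure.measurable_rnDeriv _ _).div (Measure.measurable_rnDeriv _ _)).pow_const _
  · filter_upwards [hac.ae_le (rnDeriv_pi (fun _ => μ) σ hσ),
      hac.ae_le (rnDeriv_pi (fun _ => μ) (fun _ => Q) fun _ => hQ), ae_pi_of_ae σ hac']
      with y h1 h2 h3
    rw [h1, h2, ENNReal.prod_rpow_of_nonneg (by linarith)]
    simp only [div_eq_mul_inv]
    rw [Finset.prod_mul_distrib, ENNReal.prod_inv_distrib]
    -- Inverting the product factorwise is legitimate in `[0, ∞]` because no factor is infinite,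
    -- which rules out `0 * ∞`.
    exact fun i _ j _ _ => Or.inr (h3 j).ne

/-- `P`-almost everywhere the numerator is positive and the denominator finite. Positivity is needed
to take real logarithms of products of these integrals. -/
theorem renyiIntegral_pos (μ : Measure Y) [SigmaFinite μ] {α : ℝ} (hα : 1 < α) (P Q : Measure Y)
    [IsProbabilityMeasure P] [IsProbabilityMeasure Q] (hP : P ≪ μ) :
    0 < renyiIntegral μ α P Q := by
  have hm : Measurable fun y => (P.rnDeriv μ y / Q.rnDeriv μ y) ^ (α - 1) :=
    ((Measure.measurable_rnDeriv _ _).div (Measure.measurable_rnDeriv _ _)).pow_const _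
  rw [renyiIntegral, lintegral_pos_iff_support hm]
  refine lt_of_lt_of_le (by simp : 0 < P Set.univ) (measure_mono_ae ?_)
  filter_upwards [Measure.rnDeriv_pos hP, hP.ae_le (Measure.rnDeriv_lt_top Q μ)] with y h1 h2 _
  have : (0 : ℝ≥0∞) < (P.rnDeriv μ y / Q.rnDeriv μ y) ^ (α - 1) :=
    ENNReal.rpow_pos_of_nonneg (ENNReal.div_pos h1.ne' h2.ne) (by linarith)
  exact this.ne'

theorem log2_mono {s t : ℝ≥0∞} (h : s ≤ t) : log2 s ≤ log2 t :=
  EReal.div_le_div_right_of_nonneg (by exact_mod_cast (Real.log_pos one_lt_two).le)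
    (ENNReal.log_monotone h)

theorem log2_ofReal_rpow (b : ℝ) : log2 (ENNReal.ofReal (2 ^ b)) = b := by
  rw [log2, ENNReal.log_ofReal_of_pos (by positivity), Real.log_rpow zero_lt_two,
    ← EReal.coe_div, mul_div_assoc, div_self (Real.log_pos one_lt_two).ne', mul_one]

theorem exp2_mul_log2_div {c : ℝ} (hc : 0 < c) (s : ℝ≥0∞) :
    exp2 ((c : EReal) * (log2 s / (c : EReal))) = s := by
  have h2 : Real.log 2 ≠ 0 := (Real.log_pos one_lt_two).ne'
  rw [exp2, EReal.mul_div_cancel (EReal.coe_ne_bot _) (EReal.coe_ne_top _)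
    (by exact_mod_cast hc.ne'), log2, EReal.div_mul_cancel (EReal.coe_ne_bot _)
    (EReal.coe_ne_top _) (by exact_mod_cast h2), ENNReal.exp_log]

theorem exp2_mul_renyiDiv {α : ℝ} (hα : 1 < α) (ref P Q : Measure Y) :
    exp2 (((α - 1 : ℝ) : EReal) * renyiDiv ref α P Q) = renyiIntegral ref α P Q :=
  exp2_mul_log2_div (sub_pos.2 hα) _

end Divergence

/-! ### Lower bounds on the equivocation -/

namespace Code

variable {A Y : Type*} [MeasurableSpace Y] {X : Finset A} {n : ℕ}

theorem sum_inv_mul_le (C : Code X Y n) (f : Fin C.M → ℝ≥0∞) {b : ℝ≥0∞} (h : ∀ m, f m ≤ b) :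
    ∑ m, (C.M : ℝ≥0∞)⁻¹ * f m ≤ b := by
  have hM : (C.M : ℝ≥0∞) ≠ 0 := by exact_mod_cast (C.L_pos.trans C.L_lt_M).ne'
  calc _ ≤ ∑ _m : Fin C.M, (C.M : ℝ≥0∞)⁻¹ * b := by gcongr; exact h _
    _ = b := by
      rw [Finset.sum_const, Finset.card_univ, Fintype.card_fin, nsmul_eq_mul, ← mul_assoc,
        ENNReal.mul_inv_cancel hM (by simp), one_mul]

/-- Any `Q` bounds the minimum from above, and an average over messages is at most a bound valid for
every codeword. -/
theorem le_equivocation (μ : Measure Y) (W : A → Measure Y) (C : Code X Y n)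
    {Q : Measure (Fin n → Y)} (hQ : Q ∈ probAC (Measure.pi fun _ : Fin n => μ)) {B : ℝ}
    (hB : 0 ≤ B) (h : ∀ m, klBits (wordDist W (C.word m)) Q ≤ ENNReal.ofReal B) :
    ((Real.logb 2 C.M - B : ℝ) : EReal) ≤ C.equivocation μ W := by
  rw [EReal.coe_sub, equivocation]
  refine EReal.sub_le_sub le_rfl ?_
  have h1 : ((ENNReal.ofReal B : ℝ≥0∞) : EReal) = B := by
    rw [EReal.coe_ennreal_ofReal, max_eq_left hB]
  rw [← h1]
  exact EReal.coe_ennreal_le_coe_ennreal_iff.2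
    ((iInf₂_le Q hQ).trans (C.sum_inv_mul_le _ h))

theorem le_renyiEquivocation (μ : Measure Y) {α : ℝ} (hα : 1 < α) (W : A → Measure Y)
    (C : Code X Y n) {Q : Measure (Fin n → Y)}
    (hQ : Q ∈ probAC (Measure.pi fun _ : Fin n => μ)) {B : ℝ}
    (h : ∀ m, renyiIntegral (Measure.pi fun _ : Fin n => μ) α (wordDist W (C.word m)) Q ≤
      ENNReal.ofReal (2 ^ ((α - 1) * B))) :
    ((Real.logb 2 C.M - B : ℝ) : EReal) ≤ C.renyiEquivocation μ α W := by
  have hα' : 0 < α - 1 := sub_pos.2 hα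
  rw [EReal.coe_sub, renyiEquivocation]
  refine EReal.sub_le_sub le_rfl ((iInf₂_le Q hQ).trans ?_)
  rw [EReal.div_le_iff_le_mul (by exact_mod_cast hα') (EReal.coe_ne_top _), ← EReal.coe_mul]
  refine (log2_mono (C.sum_inv_mul_le _ fun m => ?_)).trans_eq (log2_ofReal_rpow _)
  rw [exp2_mul_renyiDiv hα]
  exact h m

end Code

/-! ### Construction of the codes -/

section Support

variable {A Y : Type*} [MeasurableSpace Y] {X : Finset A} {P : X → ℝ}

theorem sum_subtype_pos {ι N : Type*} [Fintype ι] [AddCommMonoid N] (P : ι → ℝ)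
    [Fintype {x // 0 < P x}] (f : ι → N) (h : ∀ x, ¬ 0 < P x → f x = 0) :
    ∑ s : {x // 0 < P x}, f s = ∑ x, f x := by
  classical
  rw [← Finset.sum_subtype (Finset.univ.filter fun x => 0 < P x) (by simp) f]
  exact Finset.sum_filter_of_ne fun x _ hx => by_contra fun hn => hx (h x hn)

theorem eq_zero_of_not_pos (hP : P ∈ stdSimplex ℝ X) {x : X} (hx : ¬ 0 < P x) : P x = 0 :=
  le_antisymm (not_lt.1 hx) (hP.1 x)

theorem mix_subtype_pos (W : A → Measure Y) (hP : P ∈ stdSimplex ℝ X)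
    [Fintype {x : X // 0 < P x}] :
    mix (fun s : {x : X // 0 < P x} => W s.1) (fun s => P s) = outDist W P :=
  sum_subtype_pos P (fun x => ENNReal.ofReal (P x) • W x) fun x hx => by
    simp [eq_zero_of_not_pos hP hx]

theorem klDiv_outDist_ne_top (W : A → Measure Y) [∀ a, IsProbabilityMeasure (W a)]
    (hP : P ∈ stdSimplex ℝ X) {x : X} (hx : 0 < P x) : klDiv (W x) (outDist W P) ≠ ⊤ := by
  classical
  rw [← mix_subtype_pos W hP]
  exact klDiv_mix_ne_top (fun s : {x : X // 0 < P x} => W s.1) (fun s => s.2) ⟨x, hx⟩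

theorem klBits_eq_ofReal {μ ν : Measure Y} (h : klDiv μ ν ≠ ⊤) :
    klBits μ ν = ENNReal.ofReal ((klDiv μ ν).toReal / Real.log 2) := by
  rw [klBits, ENNReal.ofReal_div_of_pos (Real.log_pos one_lt_two), ENNReal.ofReal_toReal h]

theorem mutualInfo_eq (W : A → Measure Y) [∀ a, IsProbabilityMeasure (W a)]
    (hP : P ∈ stdSimplex ℝ X) : mutualInfo W P =
      ENNReal.ofReal (∑ x, P x * ((klDiv (W x) (outDist W P)).toReal / Real.log 2)) := by
  have hl2 := Real.log_pos one_lt_two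
  rw [mutualInfo, ENNReal.ofReal_sum_of_nonneg fun x _ =>
    mul_nonneg (hP.1 x) (div_nonneg ENNReal.toReal_nonneg hl2.le)]
  refine Finset.sum_congr rfl fun x _ => ?_
  by_cases hx : 0 < P x
  · rw [ENNReal.ofReal_mul hx.le, klBits_eq_ofReal (klDiv_outDist_ne_top W hP hx)]
  · simp [eq_zero_of_not_pos hP hx]

theorem coe_mutualInfo (W : A → Measure Y) [∀ a, IsProbabilityMeasure (W a)]
    (hP : P ∈ stdSimplex ℝ X) : (mutualInfo W P : EReal) =
      ((∑ x, P x * ((klDiv (W x) (outDist W P)).toReal / Real.log 2) : ℝ) : EReal) := by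
  rw [mutualInfo_eq W hP, EReal.coe_ennreal_ofReal, max_eq_left]
  exact Finset.sum_nonneg fun x _ =>
    mul_nonneg (hP.1 x) (div_nonneg ENNReal.toReal_nonneg (Real.log_pos one_lt_two).le)

/-- The factor two is for the triangle inequality: no input is within less than `r` of two different
honest letters. -/
theorem exists_pos_forall_two_mul_le_dist {A : Type*} [MetricSpace A] (X : Finset A) :
    ∃ r : ℝ, 0 < r ∧ ∀ a ∈ X, ∀ b ∈ X, a ≠ b → 2 * r ≤ dist a b := by
  classical
  rcases X.offDiag.eq_empty_or_nonempty with h | h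
  · refine ⟨1, one_pos, fun a ha b hb hab => ?_⟩
    have : (a, b) ∈ X.offDiag := Finset.mem_offDiag.2 ⟨ha, hb, hab⟩
    simp [h] at this
  · obtain ⟨z, hz, hmin⟩ := X.offDiag.exists_min_image (fun z => dist z.1 z.2) h
    refine ⟨dist z.1 z.2 / 2, half_pos (dist_pos.2 (Finset.mem_offDiag.1 hz).2.2),
      fun a ha b hb hab => ?_⟩
    have := hmin (a, b) (Finset.mem_offDiag.2 ⟨ha, hb, hab⟩)
    simp only at this
    linarith

end Support

/-! ### Numbers of messages and list sizes with prescribed rates, and the diagonal argument. -/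

section Sizes

theorem natCeil_rpow_bounds {R : ℝ} (hR : 0 ≤ R) (n : ℕ) :
    (2 : ℝ) ^ (n * R) ≤ ⌈(2 : ℝ) ^ (n * R)⌉₊ ∧
      (⌈(2 : ℝ) ^ (n * R)⌉₊ : ℝ) ≤ 2 * (2 : ℝ) ^ (n * R) := by
  refine ⟨Nat.le_ceil _, ?_⟩
  have h1 : (1 : ℝ) ≤ 2 ^ (n * R) := Real.one_le_rpow one_le_two (by positivity)
  have := Nat.ceil_lt_add_one (zero_le_one.trans h1)
  linarith

theorem le_logb_natCeil_rpow {R : ℝ} (hR : 0 ≤ R) (n : ℕ) :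
    n * R ≤ Real.logb 2 (⌈(2 : ℝ) ^ (n * R)⌉₊ : ℝ) := by
  have h := (natCeil_rpow_bounds hR n).1
  rw [Real.le_logb_iff_rpow_le one_lt_two (lt_of_lt_of_le (by positivity) h)]
  exact h

theorem tendsto_logb_natCeil_rpow {R : ℝ} (hR : 0 ≤ R) :
    Tendsto (fun n : ℕ => 1 / (n : ℝ) * Real.logb 2 (⌈(2 : ℝ) ^ (n * R)⌉₊ : ℝ)) atTop (𝓝 R) := by
  have hlim : Tendsto (fun n : ℕ => R + 1 / (n : ℝ)) atTop (𝓝 R) := by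
    simpa using (tendsto_const_div_atTop_nhds_zero_nat (1 : ℝ)).const_add R
  refine tendsto_of_tendsto_of_tendsto_of_le_of_le' tendsto_const_nhds hlim ?_ ?_
  · filter_upwards [eventually_gt_atTop 0] with n hn
    have hn' : (0 : ℝ) < n := Nat.cast_pos.2 hn
    rw [one_div_mul_eq_div, le_div_iff₀ hn', mul_comm]
    exact le_logb_natCeil_rpow hR n
  · filter_upwards [eventually_gt_atTop 0] with n hn
    have hn' : (0 : ℝ) < n := Nat.cast_pos.2 hn
    obtain ⟨h1, h2⟩ := natCeil_rpow_bounds hR n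
    rw [one_div_mul_eq_div, div_le_iff₀ hn', Real.logb_le_iff_le_rpow one_lt_two
      (lt_of_lt_of_le (by positivity) h1)]
    refine h2.trans_eq ?_
    have e : (R + 1 / n) * n = 1 + n * R := by field_simp; ring
    rw [e, Real.rpow_add zero_lt_two, Real.rpow_one]

theorem eventually_natCeil_rpow_lt {R₁ R₂ : ℝ} (h : R₂ < R₁) (hR : 0 ≤ R₂) :
    ∀ᶠ n : ℕ in atTop, ⌈(2 : ℝ) ^ (n * R₂)⌉₊ < ⌈(2 : ℝ) ^ (n * R₁)⌉₊ := by
  have ht : Tendsto (fun n : ℕ => (n : ℝ) * (R₁ - R₂)) atTop atTop :=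
    tendsto_natCast_atTop_atTop.atTop_mul_const (sub_pos.2 h)
  filter_upwards [ht.eventually_gt_atTop 1] with n hn
  have h1 := (natCeil_rpow_bounds hR n).2
  have h2 := (natCeil_rpow_bounds (hR.trans h.le) n).1
  have h3 : (2 : ℝ) * 2 ^ (n * R₂) < 2 ^ (n * R₁) := by
    have e : (2 : ℝ) * 2 ^ (n * R₂) = 2 ^ (1 + n * R₂) := by
      rw [Real.rpow_add zero_lt_two, Real.rpow_one]
    rw [e]
    exact Real.rpow_lt_rpow_of_exponent_lt one_lt_two (by linarith)
  exact_mod_cast h1.trans_lt (h3.trans_le h2)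

/-- Diagonal choice of a sequence. -/
theorem exists_seq_of_forall_eventually {α : ℕ → Type*} [∀ n, Nonempty (α n)]
    {G : ∀ n, ℝ → α n → Prop} (hmono : ∀ n δ δ' c, δ ≤ δ' → G n δ c → G n δ' c)
    (h : ∀ δ, 0 < δ → ∀ᶠ n in atTop, ∃ c, G n δ c) :
    ∃ c : ∀ n, α n, ∀ δ, 0 < δ → ∀ᶠ n in atTop, G n δ (c n) := by
  classical
  -- At each `n` the tolerance is `1 / (k + 1)` for the largest attainable `k ≤ n`; every fixed `K`
  -- is eventually attainable, so this `k` is eventually at least `K`.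
  set Z : ℕ → ℕ → Prop := fun n k => ∃ c, G n (1 / ((k : ℝ) + 1)) c with hZ
  have hex : ∀ n, ∃ c : α n, (∃ k, k ≤ n ∧ Z n k) →
      G n (1 / ((Nat.findGreatest (Z n) n : ℝ) + 1)) c := by
    intro n
    by_cases hk : ∃ k, k ≤ n ∧ Z n k
    · obtain ⟨k, hkn, hk'⟩ := hk
      obtain ⟨c, hc⟩ := Nat.findGreatest_spec (P := Z n) hkn hk'
      exact ⟨c, fun _ => hc⟩
    · exact ⟨Classical.arbitrary _, fun hk' => absurd hk' hk⟩
  choose c hc using hex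
  refine ⟨c, fun δ hδ => ?_⟩
  obtain ⟨K, hK⟩ := exists_nat_one_div_lt hδ
  filter_upwards [h _ (Nat.one_div_pos_of_nat (n := K) (α := ℝ)), eventually_ge_atTop K]
    with n hn hKn
  refine hmono n _ _ _ ?_ (hc n ⟨K, hKn, hn⟩)
  have h1 : K ≤ Nat.findGreatest (Z n) n := Nat.le_findGreatest hKn hn
  exact (Nat.one_div_le_one_div h1).trans hK.le

end Sizes

/-! ### Codes that combine list decoding with verification of the input word. -/

section Construction

variable {A Y : Type*} [MeasurableSpace Y] {X : Finset A}

instance {W : A → Measure Y} [∀ a, IsProbabilityMeasure (W a)] {n : ℕ} (x : Fin n → A) :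
    IsProbabilityMeasure (wordDist W x) := by
  unfold wordDist; infer_instance

theorem measurable_sum_apply {ξ : A → Y → ℝ} (hξ : ∀ a, Measurable (ξ a)) {n : ℕ} (x : Fin n → A) :
    Measurable fun y : Fin n → Y => ∑ i, ξ (x i) (y i) :=
  Finset.measurable_fun_sum _ fun i _ => (hξ (x i)).comp (measurable_pi_apply i)

theorem Code.measurableSet_mem_dec {n : ℕ} (C : Code X Y n) (m : Fin C.M) :
    MeasurableSet {y | m ∈ C.dec y} := by
  have e : {y | m ∈ C.dec y} = ⋃ S ∈ {S : Finset (Fin C.M) | m ∈ S}, C.dec ⁻¹' {S} := by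
    ext y; simp
  rw [e]
  exact MeasurableSet.biUnion (Set.to_countable _) fun S _ => C.measurableSet_dec S

theorem Code.missProb_eq (W : A → Measure Y) [∀ a, IsProbabilityMeasure (W a)] {n : ℕ}
    (C : Code X Y n) (x : Fin n → A) (m : Fin C.M) :
    C.missProb W x m = wordDist W x {y | m ∈ C.dec y}ᶜ :=
  (prob_compl_eq_one_sub (C.measurableSet_mem_dec m)).symm

theorem Code.one_sub_missProb (W : A → Measure Y) [∀ a, IsProbabilityMeasure (W a)] {n : ℕ}
    (C : Code X Y n) (x : Fin n → A) (m : Fin C.M) :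
    1 - C.missProb W x m = wordDist W x {y | m ∈ C.dec y} :=
  ENNReal.sub_sub_cancel ENNReal.one_ne_top prob_le_one

open Classical in
/-- The code with the codewords `c` whose lists consist of the messages `m` with `y ∈ D m`. -/
def codeOfRegions {n M L : ℕ} (hL : 0 < L) (hLM : L < M) (c : Fin M → Fin n → X)
    (D : Fin M → Set (Fin n → Y)) (hD : ∀ m, MeasurableSet (D m))
    (hcard : ∀ y (s : Finset (Fin M)), (∀ m ∈ s, y ∈ D m) → s.card ≤ L) : Code X Y n where
  M := M
  L := L
  L_pos := hL
  L_lt_M := hLM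
  enc := c
  dec y := Finset.univ.filter fun m => y ∈ D m
  card_dec_le y := hcard y _ fun m hm => (Finset.mem_filter.1 hm).2
  measurableSet_dec S := by
    have e : (fun y => Finset.univ.filter fun m => y ∈ D m) ⁻¹' {S} =
        ⋂ m, {y | y ∈ D m ↔ m ∈ S} := by
      ext y; simp [Finset.ext_iff]
    rw [e]
    refine MeasurableSet.iInter fun m => ?_
    by_cases hm : m ∈ S
    · simpa [hm] using hD m
    · simp only [hm, iff_false]
      exact (hD m).compl

theorem setOf_mem_codeOfRegions_dec {n M L : ℕ} (hL : 0 < L) (hLM : L < M)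
    (c : Fin M → Fin n → X) (D : Fin M → Set (Fin n → Y)) (hD : ∀ m, MeasurableSet (D m))
    (hcard : ∀ y (s : Finset (Fin M)), (∀ m ∈ s, y ∈ D m) → s.card ≤ L)
    (m : Fin (codeOfRegions hL hLM c D hD hcard).M) :
    {y | m ∈ (codeOfRegions hL hLM c D hD hcard).dec y} = D m := by
  classical
  ext y
  exact Finset.mem_filter_univ (p := fun m => y ∈ D m) m

/-- Of two words that are far apart, at least one is far from any given word. -/
theorem exists_far_of_hammingDist [MetricSpace A] {r : ℝ}
    (hr : ∀ a ∈ X, ∀ b ∈ X, a ≠ b → 2 * r ≤ dist a b) {S : Type*} [DecidableEq S]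
    (ι : S → X) (hι : Function.Injective ι) {n : ℕ} (c c' : Fin n → S) (x : Fin n → A) {η : ℝ}
    (h : η * n ≤ hammingDist c c') :
    η / 2 * n ≤ (Finset.univ.filter fun i => r ≤ dist (ι (c i) : A) (x i)).card ∨
      η / 2 * n ≤ (Finset.univ.filter fun i => r ≤ dist (ι (c' i) : A) (x i)).card := by
  classical
  by_contra! hcon
  have hsub : (Finset.univ.filter fun i => c i ≠ c' i) ⊆
      (Finset.univ.filter fun i => r ≤ dist (ι (c i) : A) (x i)) ∪
        Finset.univ.filter fun i => r ≤ dist (ι (c' i) : A) (x i) := by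
    intro i hi
    simp only [Finset.mem_union, Finset.mem_filter, Finset.mem_univ, true_and] at hi ⊢
    by_contra! hlt
    have h1 := hr (ι (c i)) (ι (c i)).2 (ι (c' i)) (ι (c' i)).2
      fun he => hi (hι (Subtype.ext he))
    have h2 := dist_triangle_right (ι (c i) : A) (ι (c' i)) (x i)
    linarith
  have h1 : hammingDist c c' ≤ _ := (Finset.card_le_card hsub).trans (Finset.card_union_le _ _)
  have h2 : (hammingDist c c' : ℝ) ≤
      (Finset.univ.filter fun i => r ≤ dist (ι (c i) : A) (x i)).card +
        (Finset.univ.filter fun i => r ≤ dist (ι (c' i) : A) (x i)).card := by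
    exact_mod_cast h1
  linarith [hcon.1, hcon.2]

/-- Message `m` is listed when the output lies in its list region and passes the test for its
codeword. The region handles honest errors and the list size; of any two messages, the test excludes
one for whatever word is sent. -/
theorem exists_secure_code [MetricSpace A] (W : A → Measure Y) [∀ a, IsProbabilityMeasure (W a)]
    (hW3 : CondW3 W X) {P : X → ℝ} (hP : P ∈ stdSimplex ℝ X) {R₁ R₂ : ℝ} (hR : R₂ < R₁)
    (hR₂ : 0 ≤ R₂) (hI : ((R₁ - R₂ : ℝ) : EReal) < (mutualInfo W P : EReal))
    (hH : R₁ < entropy P) (u : X → ℝ) {δ : ℝ} (hδ : 0 < δ) :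
    ∀ᶠ n : ℕ in atTop, ∃ C : Code X Y n, C.M = ⌈(2 : ℝ) ^ (n * R₁)⌉₊ ∧
      C.L = ⌈(2 : ℝ) ^ (n * R₂)⌉₊ ∧ C.epsA W ≤ ENNReal.ofReal δ ∧
      C.deltaD' W ≤ ENNReal.ofReal δ ∧ (∀ m i, 0 < P (C.enc m i)) ∧
      ∀ m, ∑ i, u (C.enc m i) ≤ n * (∑ x, P x * u x + δ) := by
  classical
  have hl2 := Real.log_pos one_lt_two
  -- Restricting to the support of `P` makes all weights positive, as the density estimates require.
  set V : {x : X // 0 < P x} → Measure Y := fun s => W s.1 with hV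
  have hmix : mix V (fun s => P s) = outDist W P := mix_subtype_pos W hP
  have hsum : ∀ f : X → ℝ, ∑ s : {x : X // 0 < P x}, P s * f s = ∑ x, P x * f x := fun f =>
    sum_subtype_pos P (fun x => P x * f x) fun x hx => by simp [eq_zero_of_not_pos hP hx]
  have hp1 : ∑ s : {x : X // 0 < P x}, P s = 1 := by
    exact (sum_subtype_pos P P fun x hx => eq_zero_of_not_pos hP hx).trans hP.2
  have hexp : ∀ (n : ℕ) (R : ℝ), Real.exp (n * (R * Real.log 2)) = 2 ^ (n * R) := fun n R => by
    rw [Real.rpow_def_of_pos zero_lt_two]; congr 1; ring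
  -- The list code works with natural logarithms, so rates in bits are multiplied by `log 2`.
  obtain ⟨η, hη, hcode⟩ := exists_listCode V (p := fun s => P s) (fun s => s.2) hp1
    (ρ₁ := R₁ * Real.log 2) (ρ₂ := R₂ * Real.log 2) (by
      rw [hsum fun x => -Real.log (P x)]
      have : entropy P = (∑ x, P x * -Real.log (P x)) / Real.log 2 := by
        rw [entropy, ← Finset.sum_neg_distrib, Finset.sum_div]
        refine Finset.sum_congr rfl fun x _ => ?_
        rw [Real.logb]; ring
      rwa [this, lt_div_iff₀ hl2] at hH) (by
      rw [hmix, hsum fun x => (klDiv (W x) (outDist W P)).toReal]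
      rw [coe_mutualInfo W hP, EReal.coe_lt_coe_iff] at hI
      have e : ∑ x, P x * ((klDiv (W x) (outDist W P)).toReal / Real.log 2) =
          (∑ x, P x * (klDiv (W x) (outDist W P)).toReal) / Real.log 2 := by
        rw [Finset.sum_div]
        exact Finset.sum_congr rfl fun x _ => by ring
      rw [e, lt_div_iff₀ hl2] at hI
      linarith)
    (fun s => u s) hδ (fun n => ⌈(2 : ℝ) ^ (n * R₁)⌉₊) (fun n => ⌈(2 : ℝ) ^ (n * R₂)⌉₊)
    (Eventually.of_forall fun n => by
      rw [hexp]; exact (natCeil_rpow_bounds (hR₂.trans hR.le) n).2)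
    (Eventually.of_forall fun n => by
      rw [hexp]; exact (natCeil_rpow_bounds hR₂ n).1)
  obtain ⟨r, hr0, hr⟩ := exists_pos_forall_two_mul_le_dist X
  obtain ⟨ξ, κ, e, hξ, he, htest⟩ := hW3.exists_verification (half_pos hη) hr0
  filter_upwards [hcode (δ / 2) (half_pos hδ), eventually_natCeil_rpow_lt hR hR₂,
    eventually_gt_atTop 0, he.eventually_le_const (show 0 < ENNReal.ofReal (δ / 2) by simpa using hδ)]
    with n hn hLM hn0 hen
  obtain ⟨c, B, hBm, hBc, hBmiss, hcu, hcd⟩ := hn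
  set w : Fin ⌈(2 : ℝ) ^ (n * R₁)⌉₊ → Fin n → A := fun m i => ((c m i).1 : A) with hw
  set K : Fin ⌈(2 : ℝ) ^ (n * R₁)⌉₊ → Set (Fin n → Y) := fun m =>
    {y | -(κ * n) ≤ ∑ i, ξ (w m i) (y i)} with hK
  have hKm : ∀ m, MeasurableSet (K m) := fun m =>
    measurableSet_le measurable_const (measurable_sum_apply hξ _)
  set C : Code X Y n := codeOfRegions (Nat.ceil_pos.2 (by positivity)) hLM (fun m i => (c m i).1)
    (fun m => B m ∩ K m) (fun m => (hBm m).inter (hKm m))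
    (fun y s hs => hBc y s fun m hm => (hs m hm).1) with hC
  have hdec : ∀ m, {y | m ∈ C.dec y} = B m ∩ K m := setOf_mem_codeOfRegions_dec _ _ _ _ _ _
  refine ⟨C, rfl, rfl, iSup_le fun m => ?_, iSup_le fun x => iSup_le fun m => iSup_le fun m' =>
    iSup_le fun hmm => ?_, fun m i => (c m i).2, fun m => ?_⟩
  · rw [C.missProb_eq W, hdec, Set.compl_inter]
    refine (measure_union_le _ _).trans ?_
    calc _ ≤ ENNReal.ofReal (δ / 2) + ENNReal.ofReal (δ / 2) :=
          add_le_add (hBmiss m) (((htest n hn0 (w m)).1).trans hen)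
      _ = _ := by rw [← ENNReal.ofReal_add (by positivity) (by positivity), add_halves]
  · dsimp only
    rw [C.one_sub_missProb W, C.one_sub_missProb W, hdec, hdec]
    have hfar := exists_far_of_hammingDist hr (fun s : {x : X // 0 < P x} => s.1)
      Subtype.val_injective (c m) (c m') x (hcd m m' hmm)
    have hle : e n ≤ ENNReal.ofReal δ :=
      hen.trans (ENNReal.ofReal_le_ofReal (by linarith))
    rcases hfar with hf | hf
    · exact (min_le_left _ _).trans ((measure_mono Set.inter_subset_right).trans
        (((htest n hn0 (w m)).2 x (fun i => (c m i).1.2) hf).trans hle))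
    · exact (min_le_right _ _).trans ((measure_mono Set.inter_subset_right).trans
        (((htest n hn0 (w m')).2 x (fun i => (c m' i).1.2) hf).trans hle))
  · rw [← hsum u]
    exact hcu m

end Construction

/-! ### Sequences of codes and single-letter bounds on their equivocation. -/

section Achievability

variable {A Y : Type*} [MeasurableSpace Y] {X : Finset A}

/-- Two messages with always empty lists: a placeholder for the block lengths at which no good code
is available. -/
instance [Nonempty X] (n : ℕ) : Nonempty (Code X Y n) :=
  ⟨codeOfRegions one_pos one_lt_two (fun _ _ => Classical.arbitrary X) (fun _ => ∅)
    (fun _ => MeasurableSet.empty) fun y s hs => by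
      rw [Finset.eq_empty_of_forall_notMem fun m hm => hs m hm]; simp⟩

theorem tendsto_zero_of_forall_eventually_le_ofReal {f : ℕ → ℝ≥0∞}
    (h : ∀ δ : ℝ, 0 < δ → ∀ᶠ n in atTop, f n ≤ ENNReal.ofReal δ) : Tendsto f atTop (𝓝 0) := by
  rw [ENNReal.tendsto_nhds_zero]
  intro ε hε
  have h1 : min ε 1 ≠ ⊤ := ((min_le_right _ _).trans_lt ENNReal.one_lt_top).ne
  have h2 : 0 < (min ε 1).toReal := ENNReal.toReal_pos (lt_min hε one_pos).ne' h1
  filter_upwards [h _ h2] with n hn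
  rw [ENNReal.ofReal_toReal h1] at hn
  exact hn.trans (min_le_left _ _)

/-- Secure codes whose equivocation is bounded below through the empirical mean of a function of
the letters of the codewords. -/
theorem exists_codes_of_le_equivocation [MetricSpace A] (W : A → Measure Y)
    [∀ a, IsProbabilityMeasure (W a)] (hW3 : CondW3 W X) {P : X → ℝ} (hP : P ∈ stdSimplex ℝ X)
    {R₁ R₂ R₃ : ℝ} (hR : R₂ < R₁) (hR₂ : 0 ≤ R₂)
    (hI : ((R₁ - R₂ : ℝ) : EReal) < (mutualInfo W P : EReal)) (hH : R₁ < entropy P)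
    (E : ∀ n, Code X Y n → EReal)
    (hE : ∀ δ : ℝ, 0 < δ → ∃ u : X → ℝ, ∑ x, P x * u x ≤ R₁ - R₃ + δ ∧
      ∀ n (C : Code X Y n) (B : ℝ), (∀ m i, 0 < P (C.enc m i)) →
        (∀ m, ∑ i, u (C.enc m i) ≤ B) → ((Real.logb 2 C.M - B : ℝ) : EReal) ≤ E n C) :
    ∃ C : ∀ n, Code X Y n, UltimatelySecure W C ∧ HasRates C R₁ R₂ ∧
      (R₃ : EReal) ≤ liminf (fun n : ℕ => ((1 / n : ℝ) : EReal) * E n (C n)) atTop := by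
  have hne : Nonempty X := by
    by_contra hn
    rw [not_nonempty_iff] at hn
    simpa using hP.2
  obtain ⟨C, hC⟩ := exists_seq_of_forall_eventually (α := fun n => Code X Y n)
    (G := fun n δ C => C.M = ⌈(2 : ℝ) ^ (n * R₁)⌉₊ ∧ C.L = ⌈(2 : ℝ) ^ (n * R₂)⌉₊ ∧
      C.epsA W ≤ ENNReal.ofReal δ ∧ C.deltaD' W ≤ ENNReal.ofReal δ ∧
      ((n * (R₃ - δ) : ℝ) : EReal) ≤ E n C)
    (fun n δ δ' C hδ h => ⟨h.1, h.2.1, h.2.2.1.trans (ENNReal.ofReal_le_ofReal hδ),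
      h.2.2.2.1.trans (ENNReal.ofReal_le_ofReal hδ), le_trans (by
        rw [EReal.coe_le_coe_iff]; gcongr) h.2.2.2.2⟩)
    (by
      intro δ hδ
      obtain ⟨u, hu, huE⟩ := hE (δ / 2) (half_pos hδ)
      filter_upwards [exists_secure_code W hW3 hP hR hR₂ hI hH u (half_pos hδ)] with n hn
      obtain ⟨C, hM, hL, h1, h2, hpos, hsum⟩ := hn
      have hδ2 : ENNReal.ofReal (δ / 2) ≤ ENNReal.ofReal δ :=
        ENNReal.ofReal_le_ofReal (by linarith)
      refine ⟨C, hM, hL, h1.trans hδ2, h2.trans hδ2, le_trans ?_ (huE n C _ hpos hsum)⟩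
      rw [EReal.coe_le_coe_iff, hM]
      have h3 := le_logb_natCeil_rpow (hR₂.trans hR.le) n
      have h4 : (n : ℝ) * (∑ x, P x * u x + δ / 2) ≤ n * (R₁ - R₃ + δ) :=
        mul_le_mul_of_nonneg_left (by linarith) (Nat.cast_nonneg n)
      linarith)
  refine ⟨C, ⟨?_, ?_⟩, ⟨?_, ?_⟩, ?_⟩
  · exact tendsto_zero_of_forall_eventually_le_ofReal fun δ hδ => (hC δ hδ).mono fun n h => h.2.2.1
  · exact tendsto_zero_of_forall_eventually_le_ofReal fun δ hδ =>
      (hC δ hδ).mono fun n h => h.2.2.2.1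
  · exact (tendsto_logb_natCeil_rpow (hR₂.trans hR.le)).congr'
      ((hC 1 one_pos).mono fun n h => by simp only [h.1])
  · exact (tendsto_logb_natCeil_rpow hR₂).congr'
      ((hC 1 one_pos).mono fun n h => by simp only [h.2.1])
  · rw [← EReal.ge_of_forall_gt_iff_ge]
    intro z hz
    have hz' : 0 < R₃ - z := sub_pos.2 (EReal.coe_lt_coe_iff.1 hz)
    refine le_liminf_of_le (by isBoundedDefault) ?_
    filter_upwards [hC _ hz', eventually_gt_atTop 0] with n h hn
    have hn' : (0 : ℝ) < n := Nat.cast_pos.2 hn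
    have e : (z : EReal) = ((1 / n : ℝ) : EReal) * ((n * (R₃ - (R₃ - z)) : ℝ) : EReal) := by
      rw [← EReal.coe_mul, EReal.coe_eq_coe_iff]
      field_simp
      ring
    rw [e]
    exact mul_le_mul_of_nonneg_left h.2.2.2.2 (by exact_mod_cast (one_div_pos.2 hn').le)

theorem pi_mem_probAC {μ : Measure Y} [SigmaFinite μ] {Q : Measure Y} (hQ : Q ∈ probAC μ) (n : ℕ) :
    Measure.pi (fun _ : Fin n => Q) ∈ probAC (Measure.pi fun _ : Fin n => μ) := by
  have := hQ.1
  exact ⟨inferInstance, pi_absolutelyContinuous (fun _ => μ) (fun _ => Q) fun _ => hQ.2⟩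

theorem outDist_mem_probAC {μ : Measure Y} {W : A → Measure Y} [∀ a, IsProbabilityMeasure (W a)]
    (hWμ : ∀ a, W a ≪ μ) {P : X → ℝ} (hP : P ∈ stdSimplex ℝ X) : outDist W P ∈ probAC μ := by
  refine ⟨isProbabilityMeasure_mix (fun x : X => W x) hP.1 hP.2, fun s hs => ?_⟩
  simp [outDist, Measure.finsetSum_apply, hWμ _ hs]

/-- The letter function is `u x = D(W x ‖ W_P)`, with mean `I(X;Y)_P`; divergence from a power of
`W_P` is additive over the letters, and finite as they lie in the support of `P`. -/
theorem exists_le_equivocation (μ : Measure Y) [SigmaFinite μ] (W : A → Measure Y)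
    [∀ a, IsProbabilityMeasure (W a)] (hWμ : ∀ a, W a ≪ μ) {P : X → ℝ} (hP : P ∈ stdSimplex ℝ X)
    {R : ℝ} (hI : (mutualInfo W P : EReal) ≤ (R : EReal)) :
    ∃ u : X → ℝ, ∑ x, P x * u x ≤ R ∧
      ∀ n (C : Code X Y n) (B : ℝ), (∀ m i, 0 < P (C.enc m i)) →
        (∀ m, ∑ i, u (C.enc m i) ≤ B) →
        ((Real.logb 2 C.M - B : ℝ) : EReal) ≤ C.equivocation μ W := by
  have hl2 := Real.log_pos one_lt_two
  rw [coe_mutualInfo W hP, EReal.coe_le_coe_iff] at hI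
  refine ⟨fun x => (klDiv (W x) (outDist W P)).toReal / Real.log 2, hI, fun n C B hpos hB => ?_⟩
  have hQ := outDist_mem_probAC hWμ hP
  have := hQ.1
  have hu : ∀ x : X, 0 ≤ (klDiv (W x) (outDist W P)).toReal / Real.log 2 := fun x =>
    div_nonneg ENNReal.toReal_nonneg hl2.le
  have hB0 : 0 ≤ B := (Finset.sum_nonneg fun i _ => hu _).trans
    (hB ⟨0, C.L_pos.trans C.L_lt_M⟩)
  refine C.le_equivocation μ W (pi_mem_probAC hQ n) hB0 fun m => ?_
  have hne : ∀ i, klDiv (W (C.enc m i)) (outDist W P) ≠ ⊤ := fun i =>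
    klDiv_outDist_ne_top W hP (hpos m i)
  have hkl : klDiv (wordDist W (C.word m)) (Measure.pi fun _ => outDist W P) =
      ∑ i, klDiv (W (C.enc m i)) (outDist W P) :=
    klDiv_pi (fun i => W (C.enc m i)) (fun _ => outDist W P)
      (fun i => (klDiv_ne_top_iff.1 (hne i)).1) fun i => (klDiv_ne_top_iff.1 (hne i)).2
  rw [klBits_eq_ofReal (by rw [hkl]; exact ENNReal.sum_ne_top.2 fun i _ => hne i), hkl,
    ENNReal.toReal_sum fun i _ => hne i, Finset.sum_div]
  exact ENNReal.ofReal_le_ofReal (hB m)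

/-- The strict bound supplies a `Q` without the minimum having to be attained. The letter function
is `D_α(W x ‖ Q)`, and concavity of the logarithm bounds its `P`-mean by the functional minimised in
`I_α`. -/
theorem exists_le_renyiEquivocation (μ : Measure Y) [SigmaFinite μ] {α : ℝ} (hα : 1 < α)
    (W : A → Measure Y) [∀ a, IsProbabilityMeasure (W a)] (hWμ : ∀ a, W a ≪ μ) {P : X → ℝ}
    (hP : P ∈ stdSimplex ℝ X) {R : ℝ} (hI : renyiMutualInfo μ α W P < (R : EReal)) :
    ∃ u : X → ℝ, ∑ x, P x * u x ≤ R ∧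
      ∀ n (C : Code X Y n) (B : ℝ), (∀ m i, 0 < P (C.enc m i)) →
        (∀ m, ∑ i, u (C.enc m i) ≤ B) →
        ((Real.logb 2 C.M - B : ℝ) : EReal) ≤ C.renyiEquivocation μ α W := by
  classical
  have hα' : 0 < α - 1 := sub_pos.2 hα
  have hl2 := Real.log_pos one_lt_two
  simp only [renyiMutualInfo, iInf_lt_iff] at hI
  obtain ⟨Q, hQ, hlt⟩ := hI
  have := hQ.1
  simp only [exp2_mul_renyiDiv hα] at hlt
  set G : X → ℝ≥0∞ := fun x => renyiIntegral μ α (W x) Q with hG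
  have hT : ∑ x, ENNReal.ofReal (P x) * G x < ENNReal.ofReal (2 ^ ((α - 1) * R)) := by
    rw [EReal.div_lt_iff (by exact_mod_cast hα') (EReal.coe_ne_top _), ← EReal.coe_mul,
      mul_comm R, ← log2_ofReal_rpow] at hlt
    exact not_le.1 fun h => hlt.not_ge (log2_mono h)
  have hGtop : ∀ x, 0 < P x → G x ≠ ⊤ := by
    intro x hx htop
    have h1 : ENNReal.ofReal (P x) * G x ≤ ∑ x, ENNReal.ofReal (P x) * G x :=
      Finset.single_le_sum (f := fun x => ENNReal.ofReal (P x) * G x) (fun _ _ => zero_le)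
        (Finset.mem_univ x)
    rw [htop, ENNReal.mul_top (by simpa using hx), top_le_iff] at h1
    exact (h1 ▸ hT).ne_top rfl
  have hGpos : ∀ x, 0 < P x → 0 < (G x).toReal := fun x hx =>
    ENNReal.toReal_pos (renyiIntegral_pos μ hα (W x) Q (hWμ x)).ne' (hGtop x hx)
  refine ⟨fun x => Real.logb 2 (G x).toReal / (α - 1), ?_, fun n C B hpos hB => ?_⟩
  · have hs1 := sum_subtype_pos P (fun x => P x * (Real.logb 2 (G x).toReal / (α - 1)))
      fun x hx => by simp [eq_zero_of_not_pos hP hx]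
    have hs2 := sum_subtype_pos P (fun x => ENNReal.ofReal (P x) * G x)
      fun x hx => by simp [eq_zero_of_not_pos hP hx]
    have hs3 := (sum_subtype_pos P P fun x hx => eq_zero_of_not_pos hP hx).trans hP.2
    have hjensen := strictConcaveOn_log_Ioi.concaveOn.le_map_sum (t := Finset.univ)
      (w := fun s : {x : X // 0 < P x} => P s) (p := fun s => (G s).toReal)
      (fun s _ => s.2.le) hs3 fun s _ => hGpos s s.2
    simp only [smul_eq_mul] at hjensen
    have hne : Nonempty {x : X // 0 < P x} := by
      by_contra hn
      rw [not_nonempty_iff] at hn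
      simp at hs3
    have hpos : 0 < ∑ s : {x : X // 0 < P x}, P s * (G s).toReal :=
      Finset.sum_pos (fun s _ => mul_pos s.2 (hGpos s s.2)) Finset.univ_nonempty
    have hle : ∑ s : {x : X // 0 < P x}, P s * (G s).toReal ≤ 2 ^ ((α - 1) * R) := by
      rw [← ENNReal.ofReal_le_ofReal_iff (by positivity),
        ENNReal.ofReal_sum_of_nonneg fun s _ => mul_nonneg s.2.le ENNReal.toReal_nonneg]
      refine le_trans (le_of_eq ?_) (hs2 ▸ hT.le)
      refine Finset.sum_congr rfl fun s _ => ?_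
      rw [ENNReal.ofReal_mul s.2.le, ENNReal.ofReal_toReal (hGtop s s.2)]
    have hlog := Real.log_le_log hpos hle
    rw [Real.log_rpow zero_lt_two] at hlog
    rw [← hs1]
    calc _ = (∑ s : {x : X // 0 < P x}, P s * Real.log (G s).toReal) /
          ((α - 1) * Real.log 2) := by
          rw [Finset.sum_div]
          refine Finset.sum_congr rfl fun s _ => ?_
          rw [Real.logb]
          field_simp
      _ ≤ R := by
          rw [div_le_iff₀ (mul_pos hα' hl2)]
          linarith
  · refine C.le_renyiEquivocation μ hα W (pi_mem_probAC hQ n) fun m => ?_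
    have hpi : renyiIntegral (Measure.pi fun _ : Fin n => μ) α (wordDist W (C.word m))
        (Measure.pi fun _ => Q) = ∏ i, G (C.enc m i) :=
      renyiIntegral_pi μ hα (fun i => W (C.enc m i)) (fun i => hWμ _) Q hQ.2
    rw [hpi, ← ENNReal.ofReal_toReal (ENNReal.prod_ne_top fun i _ => hGtop _ (hpos m i))]
    refine ENNReal.ofReal_le_ofReal ?_
    have hp : 0 < ∏ i, (G (C.enc m i)).toReal := Finset.prod_pos fun i _ => hGpos _ (hpos m i)
    rw [ENNReal.toReal_prod, ← Real.logb_le_iff_le_rpow one_lt_two hp,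
      Real.logb_prod _ _ fun i _ => (hGpos _ (hpos m i)).ne']
    have := hB m
    rw [← Finset.sum_div, div_le_iff₀ hα'] at this
    linarith

end Achievability

end SecureList

end

theorem mainTheorem6 {A Y : Type*} [MetricSpace A] [MeasurableSpace Y]
    (μ : MeasureTheory.Measure Y) [MeasureTheory.SigmaFinite μ]
    (W : A → MeasureTheory.Measure Y) [∀ a, MeasureTheory.IsProbabilityMeasure (W a)]
    (hWμ : ∀ a, (W a).AbsolutelyContinuous μ)
    (X : Finset A) (hW2 : SecureList.CondW2 W X) (hW3 : SecureList.CondW3 W X)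
    (R₁ R₂ R₃ : ℝ) :
    ((∃ P ∈ stdSimplex ℝ X,
        0 < R₁ - R₂ ∧
        ((R₁ - R₂ : ℝ) : EReal) < (SecureList.mutualInfo W P : EReal) ∧
        (SecureList.mutualInfo W P : EReal) ≤ ((R₁ - R₃ : ℝ) : EReal) ∧
        R₁ - R₃ ≤ R₁ ∧
        R₁ < SecureList.entropy P) →
      SecureList.UltimatelyAchievable μ W X R₁ R₂ R₃) ∧
    (∀ α : ℝ, 1 < α →
      (∃ P ∈ stdSimplex ℝ X,
        0 < R₁ - R₂ ∧
        ((R₁ - R₂ : ℝ) : EReal) < (SecureList.mutualInfo W P : EReal) ∧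
        (SecureList.mutualInfo W P : EReal) ≤ SecureList.renyiMutualInfo μ α W P ∧
        SecureList.renyiMutualInfo μ α W P ≤ ((R₁ - R₃ : ℝ) : EReal) ∧
        R₁ - R₃ ≤ R₁ ∧
        R₁ < SecureList.entropy P) →
      SecureList.RenyiUltimatelyAchievable μ α W X R₁ R₂ R₃) := by
  refine ⟨fun ⟨P, hP, h0, h1, h2, h3, h4⟩ => ?_, fun α hα ⟨P, hP, h0, h1, h2, h2', h3, h4⟩ => ?_⟩
  -- Hence `R₂ > R₃ ≥ 0`, so the list size has a nonnegative rate.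
  · have hlt : R₁ - R₂ < R₁ - R₃ := EReal.coe_lt_coe_iff.1 (h1.trans_le h2)
    refine SecureList.exists_codes_of_le_equivocation W hW3 hP (by linarith) (by linarith) h1 h4
      (fun n C => C.equivocation μ W) fun δ hδ => ?_
    exact SecureList.exists_le_equivocation μ W hWμ hP
      (h2.trans (EReal.coe_le_coe_iff.2 (by linarith)))
  · have hlt : R₁ - R₂ < R₁ - R₃ := EReal.coe_lt_coe_iff.1 (h1.trans_le (h2.trans h2'))
    refine SecureList.exists_codes_of_le_equivocation W hW3 hP (by linarith) (by linarith) h1 h4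
      (fun n C => C.renyiEquivocation μ α W) fun δ hδ => ?_
    exact SecureList.exists_le_renyiEquivocation μ hα W hWμ hP
      (h2'.trans_lt (EReal.coe_lt_coe_iff.2 (by linarith)))
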